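/- Let $A\in\mathbb{R}^{n\times n}$, $b,c\in\mathbb{R}^n$ and $G=[g_{ij}]\in\mathbb{R}^{N\times N}$ be such that all eigenvalues of the network state matrix $I_N\otimes A+G\otimes bc^T$ have negative real part. On a probability space let $w_1,\dots,w_N$ be (jointly measurable, square integrable, real) input noise processes on $\mathbb{R}$ that are mutually uncorrelated ($\mathbb{E}(w_i(s)w_j(t))=0$ for all $s,t$ and $i\ne j$), zero-mean and wide-sense stationary, with a common autocorrelation function $R_w(\tau)=\mathbb{E}(w_i(t)w_i(t+\tau))$ that is absolutely integrable. Let $S_w(\omega)=\int_{\mathbb{R}}R_w(\tau)e^{-\mathbf{j}\omega\tau}\,d\tau$ be their power spectral density (PSD), and assume $S_w>0$ on an interval $(-\Omega,\Omega)$ with $\Omega>0$. Let $x_1,\dots,x_N$ be $\mathbb{R}^n$-valued processes on $\mathbb{R}$, almost all of whose sample paths are absolutely continuous solutions of $$\dot x_i(t)=Ax_i(t)+b\Big(\sum_{j=1}^N g_{ij}y_j(t)+w_i(t)\Big),\qquad y_i(t)=c^Tx_i(t),\qquad i=1,\dots,N,$$ in steady state, meaning that the outputs have bounded power, $\sup_{t\in\mathbb{R}}\mathbb{E}(y_i(t)^2)<\infty$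 for all $i$. Let $(\lambda,u)$ be a real eigenvalue-eigenvector pair of $G$, normalized by $u^Tu=1$. Then the outputs are jointly wide-sense stationary, their cross-correlation functions $R_{y_iy_j}(\tau)=\mathbb{E}(y_i(t)y_j(t-\tau))$ are absolutely integrable, and the matrix $\mathbf{S}(\omega)=[S_{y_iy_j}(\omega)]_{i,j}$ of cross-power spectral densities (CPSDs), $S_{y_iy_j}(\omega)=\int_{\mathbb{R}}R_{y_iy_j}(\tau)e^{-\mathbf{j}\omega\tau}\,d\tau$, determines the input PSD as follows. For every $\omega\in(-\Omega,\Omega)$ at which $\mathbf{j}\omega I_n-A$ is invertible and the nodal transfer function $h(\mathbf{j}\omega)=c^T(\mathbf{j}\omega I_n-A)^{-1}b$ does not vanish, the matrix $\mathbf{S}(\omega)$ is invertible, $u^T\mathbf{S}^{-1}(\omega)u\neq0$, and $$S_w(\omega)=\frac{\lambda^2|h(\mathbf{j}\omega)|^2-2\lambda\,\mathrm{Re}\{h(\mathbf{j}\omega)\}+1}{\big(u^T\mathbf{S}^{-1}(\omega)u\big)\,|h(\mathbf{j}\omega)|^2}.$$ -/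

import Mathlib

open MeasureTheory Matrix
open scoped Kronecker

namespace DynNet

noncomputable section

/-- A square real matrix is Hurwitz if all its complex eigenvalues have negative real part. -/
def IsHurwitz {ι : Type*} [Fintype ι] [DecidableEq ι] (M : Matrix ι ι ℝ) : Prop :=
  ∀ μ ∈ spectrum ℂ (M.map (fun r : ℝ => (r : ℂ))), μ.re < 0

/-- The state matrix `I_N ⊗ A + G ⊗ b cᵀ` of the network. -/
def networkMatrix {N n : ℕ} (A : Matrix (Fin n) (Fin n) ℝ) (b c : Fin n → ℝ)
    (G : Matrix (Fin N) (Fin N) ℝ) : Matrix (Fin N × Fin n) (Fin N × Fin n) ℝ :=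
  (1 : Matrix (Fin N) (Fin N) ℝ) ⊗ₖ A + G ⊗ₖ vecMulVec b c

/-- The matrix `s I_n - A` over the complex numbers. -/
def resolventMatrix {n : ℕ} (A : Matrix (Fin n) (Fin n) ℝ) (s : ℂ) : Matrix (Fin n) (Fin n) ℂ :=
  s • (1 : Matrix (Fin n) (Fin n) ℂ) - A.map (fun r : ℝ => (r : ℂ))

/-- The nodal transfer function `h(s) = cᵀ (s I_n - A)⁻¹ b`. -/
def nodalTransfer {n : ℕ} (A : Matrix (Fin n) (Fin n) ℝ) (b c : Fin n → ℝ) (s : ℂ) : ℂ :=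
  (fun k => (c k : ℂ)) ⬝ᵥ ((resolventMatrix A s)⁻¹ *ᵥ (fun k => (b k : ℂ)))

/-- Fourier transform in angular frequency: `∫ f(τ) e^{-jωτ} dτ`. -/
def angularFourier (f : ℝ → ℝ) (ω : ℝ) : ℂ :=
  ∫ τ : ℝ, (f τ : ℂ) * Complex.exp (-(Complex.I * (ω : ℂ) * (τ : ℂ)))

section Stochastic

variable {Ω : Type*} [MeasurableSpace Ω]

/-- The cross-correlation `E(x(t) y(t - τ))` at time `t` and lag `τ`. -/
def crossCorrAt (P : Measure Ω) (x y : ℝ → Ω → ℝ) (t τ : ℝ) : ℝ :=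
  ∫ o, x t o * y (t - τ) o ∂P

/-- The cross-correlation function `R_{xy}(τ)` of jointly wide-sense stationary processes, for which
`crossCorrAt P x y t τ` does not depend on `t`. -/
def crossCorr (P : Measure Ω) (x y : ℝ → Ω → ℝ) (τ : ℝ) : ℝ :=
  crossCorrAt P x y 0 τ

/-- The cross-correlation function is absolutely integrable, so its Fourier integral exists. -/
def HasCPSD (P : Measure Ω) (x y : ℝ → Ω → ℝ) : Prop :=
  Integrable (crossCorr P x y)

/-- The cross-power spectral density `S_{xy}(ω)`. -/
def cpsd (P : Measure Ω) (x y : ℝ → Ω → ℝ) (ω : ℝ) : ℂ :=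
  angularFourier (crossCorr P x y) ω

/-- The power spectral density `S_x(ω)`. -/
def psd (P : Measure Ω) (x : ℝ → Ω → ℝ) (ω : ℝ) : ℂ :=
  cpsd P x x ω

/-- The matrix `[S_{y_i y_j}(ω)]`. -/
def cpsdMatrix {N : ℕ} (P : Measure Ω) (y : Fin N → ℝ → Ω → ℝ) (ω : ℝ) :
    Matrix (Fin N) (Fin N) ℂ :=
  Matrix.of fun i j => cpsd P (y i) (y j) ω

/-- A finite family of square integrable processes that is jointly wide-sense stationary. -/
structure JointlyWSS {N : ℕ} (P : Measure Ω) (y : Fin N → ℝ → Ω → ℝ) : Prop where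
  memLp : ∀ i t, MemLp (y i t) 2 P
  mean : ∀ i s t, ∫ o, y i s o ∂P = ∫ o, y i t o ∂P
  corr : ∀ i j s t τ, crossCorrAt P (y i) (y j) s τ = crossCorrAt P (y i) (y j) t τ

/-- The input noises are (jointly measurable) square integrable, mutually uncorrelated, zero-mean
wide-sense stationary processes with one and the same autocorrelation function. -/
structure IsUncorrelatedWSSInput {N : ℕ} (P : Measure Ω) (w : Fin N → ℝ → Ω → ℝ) : Prop where
  measurable : ∀ i, Measurable (Function.uncurry (w i))
  memLp : ∀ i t, MemLp (w i t) 2 P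
  mean_zero : ∀ i t, ∫ o, w i t o ∂P = 0
  uncorrelated : ∀ i j, i ≠ j → ∀ s t, ∫ o, w i s o * w j t o ∂P = 0
  autocorr : ∃ R : ℝ → ℝ, ∀ i t τ, ∫ o, w i t o * w i (t + τ) o ∂P = R τ

/-- `(-W, W)` is an excitation frequency interval of `w`. (The power spectral density of a real
wide-sense stationary process is real.) -/
def IsExcitationInterval {N : ℕ} (P : Measure Ω) (w : Fin N → ℝ → Ω → ℝ) (W : ℝ) : Prop :=
  0 < W ∧ ∀ ω ∈ Set.Ioo (-W) W, ∀ i, 0 < (psd P (w i) ω).re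

/-- The outputs `y_i(t) = cᵀ x_i(t)`. -/
def output {N n : ℕ} (c : Fin n → ℝ) (x : Fin N → ℝ → Ω → Fin n → ℝ) : Fin N → ℝ → Ω → ℝ :=
  fun i t o => c ⬝ᵥ x i t o

/-- The right-hand side `A x_i(t) + b (∑_j g_ij y_j(t) + w_i(t))` of the dynamics of node `i`. -/
def nodeField {N n : ℕ} (A : Matrix (Fin n) (Fin n) ℝ) (b c : Fin n → ℝ)
    (G : Matrix (Fin N) (Fin N) ℝ) (w : Fin N → ℝ → Ω → ℝ)
    (x : Fin N → ℝ → Ω → Fin n → ℝ) (i : Fin N) (t : ℝ) (o : Ω) : Fin n → ℝ :=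
  A *ᵥ x i t o + (∑ j, G i j * output c x j t o + w i t o) • b

/-- The state processes `x_i`, `t ∈ ℝ`, solve the network dynamics
`x_i' = A x_i + b (∑_j g_ij y_j + w_i)`: almost every sample path is an absolutely continuous
solution, i.e. it satisfies the integrated equation between any two times. -/
structure IsNetworkSolution {N n : ℕ} (P : Measure Ω) (A : Matrix (Fin n) (Fin n) ℝ)
    (b c : Fin n → ℝ) (G : Matrix (Fin N) (Fin N) ℝ) (w : Fin N → ℝ → Ω → ℝ)
    (x : Fin N → ℝ → Ω → Fin n → ℝ) : Prop where
  measurable : ∀ i t, Measurable (x i t)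
  ode : ∀ᵐ o ∂P, ∀ i s t,
    IntervalIntegrable (fun r => nodeField A b c G w x i r o) volume s t ∧
      x i t o - x i s o = ∫ r in s..t, nodeField A b c G w x i r o

/-- The processes `y_i` have bounded power: `sup_t E(y_i(t)²) < ∞`. -/
def HasBoundedPower {N : ℕ} (P : Measure Ω) (y : Fin N → ℝ → Ω → ℝ) : Prop :=
  ∃ K : ℝ, ∀ i t, MemLp (y i t) 2 P ∧ ∫ o, y i t o ^ 2 ∂P ≤ K

end Stochastic

end

end DynNet

/-! Stacking the nodes gives X' = M X + B w, y = C X, where M is the network state matrix, C = I ⊗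
cᵀ and B = I ⊗ b. Since M is Hurwitz, the impulse response K(r) = C exp(rM) B is integrable on (0,
∞).

The analytic core is `ae_output_eq_filteredSum`: at each time, y = K * w almost surely. The
deviation D of X from the causal response evolves freely (`sub_causalResponse_eq`). Only the outputs
have bounded power, and without observability D itself need not be bounded, so the argument is run
on z, a coordinate of C D. By Cayley–Hamilton for exp M, the samples z(t+k), k ∈ ℤ, satisfy a linear
recurrence whose characteristic roots lie in the open unit disc. Hence so does the bounded sequence
k ↦ E(z(t+k) z(t)), which must vanish; k = 0 gives E(z(t)²) = 0.

Fubini then writes each output correlation as a mixture of translates of R_w, independent of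
absolute time. Its Fourier transform is S = S_w H Hᴴ, with H the transform of K. Since H = C (jωI -
M)⁻¹ B and the coupling G ⊗ bcᵀ acts through the outputs, (I - hG) H = hI (`transfer_identity`).
With T = I - hG this gives S⁻¹ = Tᴴ T / (S_w |h|²), and Tu = (1 - λh)u with u real yields uᵀ S⁻¹ u =
|1 - λh|² / (S_w |h|²), which is solved for S_w (`eigenpair_determines_psd`). -/

namespace DynNet

open NormedSpace Filter Topology Asymptotics

/-! ### Exponential decay of the matrix exponential, and its Laplace transform. -/

section Stability

variable {ι : Type*} [Fintype ι] [DecidableEq ι]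

theorem exp_smul_mulVec_of_pow_mulVec_eq_zero (Z : Matrix ι ι ℂ) (v : ι → ℂ) (d : ℕ)
    (h : (Z ^ d) *ᵥ v = 0) (t : ℂ) :
    exp (t • Z) *ᵥ v = ∑ k ∈ Finset.range d, (t ^ k / (k.factorial : ℂ)) • ((Z ^ k) *ᵥ v) := by
  have hs : HasSum (fun k : ℕ => ((k.factorial : ℂ)⁻¹) • (t • Z) ^ k) (exp (t • Z)) := by
    open scoped Matrix.Norms.Operator in
    exact exp_series_hasSum_exp' (𝕂 := ℂ) (t • Z)
  have h1 : HasSum (fun k : ℕ => (((k.factorial : ℂ)⁻¹) • (t • Z) ^ k) *ᵥ v)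
      (exp (t • Z) *ᵥ v) :=
    hs.map (⟨⟨fun A : Matrix ι ι ℂ => A *ᵥ v, zero_mulVec v⟩, fun A B => add_mulVec A B v⟩ :
      Matrix ι ι ℂ →+ (ι → ℂ)) (continuous_id.matrix_mulVec continuous_const)
  have h2 : ∀ k : ℕ, (((k.factorial : ℂ)⁻¹) • (t • Z) ^ k) *ᵥ v
      = (t ^ k / (k.factorial : ℂ)) • ((Z ^ k) *ᵥ v) := fun k => by
    rw [smul_pow, smul_smul, smul_mulVec, div_eq_inv_mul]
  simp_rw [h2] at h1
  refine h1.unique (hasSum_sum_of_ne_finset_zero fun k hk => ?_)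
  obtain ⟨m, rfl⟩ := Nat.exists_eq_add_of_le (not_lt.1 fun hlt => hk (Finset.mem_range.2 hlt))
  rw [add_comm, pow_add Z, ← mulVec_mulVec, h, mulVec_zero, smul_zero]

theorem exp_smul_mulVec_of_genEigen (L : Matrix ι ι ℂ) (μ : ℂ) (v : ι → ℂ) (d : ℕ)
    (h : ((L - μ • 1) ^ d) *ᵥ v = 0) (t : ℂ) :
    exp (t • L) *ᵥ v = Complex.exp (t * μ) •
      ∑ k ∈ Finset.range d, (t ^ k / (k.factorial : ℂ)) • (((L - μ • 1) ^ k) *ᵥ v) := by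
  have e1 : t • L = (t * μ) • (1 : Matrix ι ι ℂ) + t • (L - μ • 1) := by
    rw [smul_sub, smul_smul]; abel
  have e2 : exp ((t * μ) • (1 : Matrix ι ι ℂ)) = Complex.exp (t * μ) • 1 := by
    rw [smul_one_eq_diagonal, Matrix.exp_diagonal, smul_one_eq_diagonal, Pi.exp_def,
      Complex.exp_eq_exp_ℂ]
  rw [e1, Matrix.exp_add_of_commute _ _ ((Commute.one_left _).smul_left _), e2, smul_mul, one_mul,
    smul_mulVec, exp_smul_mulVec_of_pow_mulVec_eq_zero _ _ _ h]

/-- Half of the decay rate is given up to absorb the polynomial factor of the Jordan block. -/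
theorem isBigO_exp_of_genEigen (L : Matrix ι ι ℂ) {μ : ℂ} (hμ : μ.re < 0) (v : ι → ℂ) (d : ℕ)
    (h : ((L - μ • 1) ^ d) *ᵥ v = 0) :
    (fun t : ℝ => exp ((t : ℂ) • L) *ᵥ v) =O[atTop] fun t => Real.exp (-(-μ.re / 2) * t) := by
  simp_rw [exp_smul_mulVec_of_genEigen L μ v d h, Finset.smul_sum]
  refine IsBigO.fun_sum fun k _ => ?_
  have h1 : (fun t : ℝ => t ^ k) =O[atTop] fun t : ℝ => Real.exp ((-μ.re / 2) * t) :=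
    (isLittleO_pow_exp_pos_mul_atTop k (by linarith)).isBigO
  have h2 := h1.mul (isBigO_refl (fun t : ℝ => Real.exp (t * μ.re)) atTop)
  have h3 : (fun t : ℝ => Complex.exp (t * μ) •
      ((t : ℂ) ^ k / (k.factorial : ℂ)) • (((L - μ • 1) ^ k) *ᵥ v)) =O[atTop]
      fun t : ℝ => t ^ k * Real.exp (t * μ.re) := by
    refine IsBigO.of_bound (‖((L - μ • 1) ^ k) *ᵥ v‖ / k.factorial) (Eventually.of_forall fun t => ?_)
    simp only [norm_smul, norm_div, norm_pow, norm_mul, Complex.norm_exp, Real.norm_eq_abs,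
      Complex.norm_real, Complex.norm_natCast, Complex.re_ofReal_mul, Real.abs_exp]
    apply le_of_eq; ring
  refine h3.trans (h2.congr_right fun t => ?_)
  rw [← Real.exp_add]; congr 1; ring

/-- The vectors with an exponentially decaying orbit form a subspace containing every generalized
eigenspace, and over ℂ these span. -/
theorem exists_isBigO_exp_mulVec (L : Matrix ι ι ℂ) (hL : ∀ μ ∈ spectrum ℂ L, μ.re < 0)
    (v : ι → ℂ) :
    ∃ ε > 0, (fun t : ℝ => exp ((t : ℂ) • L) *ᵥ v) =O[atTop] fun t => Real.exp (-ε * t) := by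
  let V : Submodule ℂ (ι → ℂ) :=
    { carrier := {v | ∃ ε > 0, (fun t : ℝ => exp ((t : ℂ) • L) *ᵥ v) =O[atTop]
        fun t => Real.exp (-ε * t)}
      add_mem' := by
        rintro v₁ v₂ ⟨ε₁, h₁, H₁⟩ ⟨ε₂, h₂, H₂⟩
        refine ⟨min ε₁ ε₂, lt_min h₁ h₂, ?_⟩
        simp_rw [mulVec_add]
        have key : ∀ ε, min ε₁ ε₂ ≤ ε → (fun t => Real.exp (-ε * t)) =O[atTop]
            fun t => Real.exp (-(min ε₁ ε₂) * t) := fun ε hε => by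
          refine IsBigO.of_bound 1 ((eventually_ge_atTop 0).mono fun t ht => ?_)
          rw [Real.norm_of_nonneg (Real.exp_pos _).le, Real.norm_of_nonneg (Real.exp_pos _).le,
            one_mul, Real.exp_le_exp]
          nlinarith
        exact (H₁.trans (key _ (min_le_left _ _))).add (H₂.trans (key _ (min_le_right _ _)))
      zero_mem' := ⟨1, one_pos, by simp_rw [mulVec_zero]; exact isBigO_zero _ _⟩
      smul_mem' := by
        rintro a v ⟨ε, h, H⟩
        refine ⟨ε, h, ?_⟩
        simp_rw [mulVec_smul]
        exact H.const_smul_left a }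
  have hV : V = ⊤ := by
    rw [eq_top_iff, ← Module.End.iSup_maxGenEigenspace_eq_top (toLin' L)]
    refine iSup_le fun μ => ?_
    by_cases hμ : Module.End.HasEigenvalue (toLin' L) μ
    · intro v hv
      obtain ⟨d, hd⟩ := (Module.End.mem_maxGenEigenspace _ _ _).1 hv
      have hre : μ.re < 0 := hL μ (by
        have := hμ.mem_spectrum
        rwa [Matrix.spectrum_toLin'] at this)
      have e : toLin' L - μ • (1 : Module.End ℂ (ι → ℂ)) = toLin' (L - μ • 1) := by
        rw [map_sub, map_smul, toLin'_one]; rfl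
      rw [e, ← Matrix.toLin'_pow, toLin'_apply] at hd
      exact ⟨-μ.re / 2, by linarith, isBigO_exp_of_genEigen L hre v d hd⟩
    · have h0 : Module.End.maxGenEigenspace (toLin' L) μ = ⊥ := by
        by_contra hne
        exact hμ (Module.End.HasUnifEigenvalue.lt (k := ⊤) (by simp) hne)
      rw [h0]; exact bot_le
  have : v ∈ V := hV ▸ Submodule.mem_top
  exact this

theorem map_ofReal_exp (M : Matrix ι ι ℝ) (t : ℝ) :
    (exp (t • M)).map (fun r : ℝ => (r : ℂ)) = exp ((t : ℂ) • M.map (fun r : ℝ => (r : ℂ))) := by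
  have h : (Complex.ofRealHom.mapMatrix (exp (t • M)) : Matrix ι ι ℂ)
      = exp (Complex.ofRealHom.mapMatrix (t • M)) := by
    open scoped Matrix.Norms.Operator in
    exact map_exp (Complex.ofRealHom.mapMatrix : Matrix ι ι ℝ →+* Matrix ι ι ℂ)
      (continuous_id.matrix_map Complex.continuous_ofReal) (t • M)
  refine h.trans (congrArg exp ?_)
  ext i j
  simp

theorem IsHurwitz.exists_isBigO {M : Matrix ι ι ℝ} (hM : IsHurwitz M) (i j : ι) :
    ∃ ε > 0, (fun t : ℝ => exp (t • M) i j) =O[atTop] fun t => Real.exp (-ε * t) := by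
  obtain ⟨ε, hε, h⟩ := exists_isBigO_exp_mulVec _ hM (Pi.single j 1)
  refine ⟨ε, hε, IsBigO.trans (IsBigO.of_bound 1 (Eventually.of_forall fun t => ?_)) h⟩
  rw [← map_ofReal_exp, one_mul]
  refine le_trans (le_of_eq ?_) (norm_le_pi_norm _ i)
  simp

theorem continuous_exp_smul_apply (M : Matrix ι ι ℝ) (i j : ι) :
    Continuous fun t : ℝ => exp (t • M) i j := by
  have h : Continuous fun t : ℝ => exp (t • M) := by
    open scoped Matrix.Norms.Operator in
    exact exp_continuous.comp (continuous_id.smul continuous_const)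
  exact h.matrix_elem i j

theorem hasDerivAt_exp_smul_apply (M : Matrix ι ι ℝ) (i j : ι) (t : ℝ) :
    HasDerivAt (fun u : ℝ => exp (u • M) i j) ((exp (t • M) * M) i j) t := by
  open scoped Matrix.Norms.Operator in
  have h := hasDerivAt_exp_smul_const (𝕂 := ℝ) M t
  exact hasDerivAt_pi.1 (hasDerivAt_pi.1 h i) j

theorem exp_add_smul (M : Matrix ι ι ℝ) (s t : ℝ) :
    exp ((s + t) • M) = exp (s • M) * exp (t • M) := by
  rw [add_smul, Matrix.exp_add_of_commute _ _ (((Commute.refl M).smul_left s).smul_right t)]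

theorem IsHurwitz.integrableOn_exp {M : Matrix ι ι ℝ} (hM : IsHurwitz M) (i j : ι) :
    IntegrableOn (fun t : ℝ => exp (t • M) i j) (Set.Ioi 0) := by
  obtain ⟨ε, hε, h⟩ := hM.exists_isBigO i j
  exact integrable_of_isBigO_exp_neg hε (continuous_exp_smul_apply M i j).continuousOn h

theorem IsHurwitz.tendsto_exp {M : Matrix ι ι ℝ} (hM : IsHurwitz M) (i j : ι) :
    Tendsto (fun t : ℝ => exp (t • M) i j) atTop (𝓝 0) := by
  obtain ⟨ε, hε, h⟩ := hM.exists_isBigO i j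
  refine h.trans_tendsto (Real.tendsto_exp_atBot.comp ?_)
  exact tendsto_id.const_mul_atTop_of_neg (by linarith)

/-- The Laplace transform of `exp (t M)` on the imaginary axis is the resolvent. -/
theorem IsHurwitz.resolvent_mul_integral {M : Matrix ι ι ℝ} (hM : IsHurwitz M) (ω : ℝ) :
    (Matrix.of fun i j => ∫ t : ℝ in Set.Ioi 0,
        (exp (t • M) i j : ℂ) * Complex.exp (-(Complex.I * ω * t))) *
      ((Complex.I * ω) • (1 : Matrix ι ι ℂ) - M.map (fun r : ℝ => (r : ℂ))) = 1 := by
  set e : ℝ → ℂ := fun t => Complex.exp (-(Complex.I * ω * t)) with he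
  have hnorm : ∀ t, ‖e t‖ = 1 := fun t => by
    rw [he, Complex.norm_exp]; simp
  have hec : Continuous e := by fun_prop
  have hint : ∀ i j, IntegrableOn (fun t : ℝ => (exp (t • M) i j : ℂ) * e t) (Set.Ioi 0) :=
    fun i j => (hM.integrableOn_exp i j).ofReal.mul_bdd (c := 1)
      hec.aestronglyMeasurable (Eventually.of_forall fun t => (hnorm t).le)
  have hde : ∀ t, HasDerivAt e (-(Complex.I * ω) * e t) t := fun t => by
    have h1 : HasDerivAt (fun t : ℝ => -(Complex.I * ω * (t : ℂ))) (-(Complex.I * ω)) t := by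
      have h2 := ((hasDerivAt_id t).ofReal_comp.const_mul (Complex.I * (ω : ℂ))).fun_neg
      simpa using h2
    simpa [he, mul_comm] using h1.cexp
  ext i j
  have hder : ∀ t ∈ Set.Ici (0 : ℝ), HasDerivAt (fun t : ℝ => (exp (t • M) i j : ℂ) * e t)
      ((∑ k, ((exp (t • M) i k : ℂ) * e t) * (M k j : ℂ))
        - (Complex.I * ω) * ((exp (t • M) i j : ℂ) * e t)) t := fun t _ => by
    have h := (hasDerivAt_exp_smul_apply M i j t).ofReal_comp.mul (hde t)
    refine h.congr_deriv ?_
    rw [mul_apply]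
    push_cast
    rw [Finset.sum_mul]
    rw [sub_eq_add_neg]
    congr 1
    · exact Finset.sum_congr rfl fun k _ => by ring
    · ring
  have hint' : IntegrableOn (fun t : ℝ => (∑ k, ((exp (t • M) i k : ℂ) * e t) * (M k j : ℂ))
        - (Complex.I * ω) * ((exp (t • M) i j : ℂ) * e t)) (Set.Ioi 0) :=
    (integrable_finsetSum _ fun k _ => (hint i k).mul_const _).sub ((hint i j).const_mul _)
  have htend : Tendsto (fun t : ℝ => (exp (t • M) i j : ℂ) * e t) atTop (𝓝 0) := by
    rw [tendsto_zero_iff_norm_tendsto_zero]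
    have := (hM.tendsto_exp i j).norm
    simpa [hnorm] using this
  -- The derivative integrates to minus the value at 0, because the function vanishes at infinity;
  -- the boundary term is the identity matrix.
  have key := integral_Ioi_of_hasDerivAt_of_tendsto' hder hint' htend
  rw [integral_sub (integrable_finsetSum _ fun k _ => (hint i k).mul_const _)
    ((hint i j).const_mul _), integral_finsetSum _ fun k _ => (hint i k).mul_const _,
    integral_const_mul] at key
  simp_rw [integral_mul_const] at key
  rw [mul_sub, Matrix.mul_smul, mul_one, Matrix.sub_apply, Matrix.smul_apply, mul_apply]
  simp only [of_apply, map_apply, smul_eq_mul]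
  have h0 : (exp ((0 : ℝ) • M) i j : ℂ) * e 0 = (1 : Matrix ι ι ℂ) i j := by
    simp [he, one_apply, apply_ite]
  rw [h0] at key
  linear_combination -key

/-- An eigenvector v satisfies ν^m v = exp(mM) v → 0, so no spectral mapping theorem is needed. -/
theorem IsHurwitz.norm_lt_one_of_mem_roots {M : Matrix ι ι ℝ} (hM : IsHurwitz M) {ν : ℂ}
    (hν : ((exp M).charpoly.map Complex.ofRealHom).IsRoot ν) : ‖ν‖ < 1 := by
  set E := (exp M).map (fun r : ℝ => (r : ℂ)) with hE
  have h1 : E.charpoly.IsRoot ν := by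
    have : E = Complex.ofRealHom.mapMatrix (exp M) := rfl
    rw [this, RingHom.mapMatrix_apply, Matrix.charpoly_map]; exact hν
  have h2 : ν ∈ spectrum ℂ E := Matrix.mem_spectrum_iff_isRoot_charpoly.2 h1
  rw [← Matrix.spectrum_toLin'] at h2
  obtain ⟨v, hv⟩ := (Module.End.HasEigenvalue.of_mem_spectrum h2).exists_hasEigenvector
  have hpow : ∀ m : ℕ, (E ^ m) *ᵥ v = ν ^ m • v := fun m => by
    have := hv.pow_apply m
    rwa [← toLin'_pow, toLin'_apply] at this
  have hEm : ∀ m : ℕ, E ^ m = (exp ((m : ℝ) • M)).map (fun r : ℝ => (r : ℂ)) := fun m => by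
    have : exp ((m : ℝ) • M) = (exp M) ^ m := by
      rw [← Matrix.exp_nsmul, Nat.cast_smul_eq_nsmul]
    rw [this]
    exact (map_pow (Complex.ofRealHom.mapMatrix : Matrix ι ι ℝ →+* Matrix ι ι ℂ) (exp M) m).symm
  obtain ⟨i, hi⟩ := Function.ne_iff.1 hv.2
  have hlim : Tendsto (fun m : ℕ => ν ^ m * v i) atTop (𝓝 0) := by
    have h3 : ∀ m : ℕ, ν ^ m * v i = ∑ j, (exp ((m : ℝ) • M) i j : ℂ) * v j := fun m => by
      have := congrFun (hpow m) i
      rw [hEm] at this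
      simpa [mulVec, dotProduct] using this.symm
    simp_rw [h3]
    rw [← Finset.sum_const_zero (s := (Finset.univ : Finset ι))]
    refine tendsto_finsetSum _ fun j _ => ?_
    have h4 := ((Complex.continuous_ofReal.tendsto 0).comp
      ((hM.tendsto_exp i j).comp tendsto_natCast_atTop_atTop)).mul_const (v j)
    simpa using h4
  have h5 : Tendsto (fun m : ℕ => ν ^ m) atTop (𝓝 0) := by
    have := hlim.mul_const (v i)⁻¹
    simpa [mul_assoc, mul_inv_cancel₀ hi] using this
  exact tendsto_pow_atTop_nhds_zero_iff_norm_lt_one.1 h5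

end Stability

/-! ### Variation of constants for absolutely continuous solutions. -/

section VariationOfConstants

variable {ι κ : Type*} [Fintype ι] [DecidableEq ι] [Fintype κ]

theorem hasDerivAt_exp_sub_smul_apply (M : Matrix ι ι ℝ) (t : ℝ) (k i : ι) (r : ℝ) :
    HasDerivAt (fun r : ℝ => exp ((t - r) • M) k i) (-(exp ((t - r) • M) * M) k i) r := by
  have h := HasDerivAt.comp_const_sub t r (hasDerivAt_exp_smul_apply M k i (t - r))
  exact h

theorem absolutelyContinuousOnInterval_exp_sub_smul_apply (M : Matrix ι ι ℝ) (t : ℝ) (k i : ι)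
    (a b : ℝ) : AbsolutelyContinuousOnInterval (fun r : ℝ => exp ((t - r) • M) k i) a b := by
  have hd := hasDerivAt_exp_sub_smul_apply M t k i
  refine ContDiffOn.absolutelyContinuousOnInterval (ContDiff.contDiffOn ?_)
  refine contDiff_one_iff_deriv.2 ⟨fun r => (hd r).differentiableAt, ?_⟩
  have : deriv (fun r : ℝ => exp ((t - r) • M) k i)
      = fun r => -∑ l, exp ((t - r) • M) k l * M l i := by
    ext r; rw [(hd r).deriv, mul_apply]
  rw [this]
  exact (continuous_finsetSum _ fun l _ => (((continuous_exp_smul_apply M k l).comp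
    (continuous_const.sub continuous_id)).mul continuous_const)).neg

/-- Variation of constants for absolutely continuous solutions of `X' = M X + v`. -/
theorem variation_of_constants (M : Matrix ι ι ℝ) (X v : ℝ → ι → ℝ)
    (hX : ∀ i r₁ r₂, IntervalIntegrable (fun r => (M *ᵥ X r + v r) i) volume r₁ r₂ ∧
      X r₂ i - X r₁ i = ∫ r in r₁..r₂, (M *ᵥ X r + v r) i) (s t : ℝ) (k : ι) :
    X t k - (exp ((t - s) • M) *ᵥ X s) k = ∫ r in s..t, (exp ((t - r) • M) *ᵥ v r) k := by
  have hφ := absolutelyContinuousOnInterval_exp_sub_smul_apply M t k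
  have hXi : ∀ i, (fun r => X r i) = fun r => X s i + ∫ u in s..r, (M *ᵥ X u + v u) i :=
    fun i => funext fun r => by rw [← (hX i s r).2]; ring
  have hXac : ∀ i, AbsolutelyContinuousOnInterval (fun r => X r i) s t := fun i => by
    rw [hXi]
    exact (contDiff_const.contDiffOn.absolutelyContinuousOnInterval).add
      ((hX i s t).1.absolutelyContinuousOnInterval_intervalIntegral Set.left_mem_uIcc)
  have hXd : ∀ i, ∀ᵐ r, r ∈ Set.uIcc s t → deriv (fun r => X r i) r = (M *ᵥ X r + v r) i :=
    fun i => by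
      filter_upwards [(hX i s t).1.ae_hasDerivAt_integral] with r hr hrm
      rw [hXi]
      exact ((hr hrm s Set.left_mem_uIcc).const_add _).deriv
  have hint : ∀ i, IntervalIntegrable (fun r =>
      deriv (fun r : ℝ => exp ((t - r) • M) k i) r * X r i
        + exp ((t - r) • M) k i * deriv (fun r => X r i) r) volume s t := fun i =>
    ((hφ i s t).intervalIntegrable_deriv.mul_continuousOn (hXac i).continuousOn).add
      ((hXac i).intervalIntegrable_deriv.continuousOn_mul (hφ i s t).continuousOn)
  -- Integration by parts for absolutely continuous functions, applied to exp((t - r)M) X(r); the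
  -- two terms containing M cancel below.
  have hsum : ∑ i, (exp ((t - t) • M) k i * X t i - exp ((t - s) • M) k i * X s i)
      = ∫ r in s..t, ∑ i, (deriv (fun r : ℝ => exp ((t - r) • M) k i) r * X r i
        + exp ((t - r) • M) k i * deriv (fun r => X r i) r) := by
    rw [intervalIntegral.integral_finsetSum fun i _ => hint i]
    exact Finset.sum_congr rfl fun i _ => ((hφ i s t).integral_deriv_mul_eq_sub (hXac i)).symm
  have hleft : ∑ i, (exp ((t - t) • M) k i * X t i - exp ((t - s) • M) k i * X s i)
      = X t k - (exp ((t - s) • M) *ᵥ X s) k := by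
    rw [Finset.sum_sub_distrib, sub_self, zero_smul, exp_zero]
    simp [one_apply, mulVec, dotProduct]
  rw [← hleft, hsum]
  refine intervalIntegral.integral_congr_ae ?_
  filter_upwards [ae_all_iff.2 hXd] with r hr hrm
  have hrm' := Set.uIoc_subset_uIcc hrm
  have e1 : ∀ i, deriv (fun r : ℝ => exp ((t - r) • M) k i) r = -(exp ((t - r) • M) * M) k i :=
    fun i => (hasDerivAt_exp_sub_smul_apply M t k i r).deriv
  simp_rw [e1, fun i => hr i hrm', Pi.add_apply, mul_add, ← add_assoc]
  rw [Finset.sum_add_distrib, Finset.sum_add_distrib]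
  have e2 : ∑ i, -(exp ((t - r) • M) * M) k i * X r i
      = -((exp ((t - r) • M) * M) *ᵥ X r) k := by
    simp [mulVec, dotProduct]
  rw [e2, ← mulVec_mulVec]
  simp [mulVec, dotProduct]

/-- The response at time `t` of the impulse response matrix `K` to the input `w`, applied since
time `-∞`. -/
noncomputable def causalResponse (K : ℝ → Matrix ι κ ℝ) (w : κ → ℝ → ℝ) (t : ℝ) : ι → ℝ :=
  fun k => ∑ j, ∫ r in Set.Ioi (0 : ℝ), K r k j * w j (t - r)

/-- The deviation of a solution from the causal response evolves by the free dynamics. -/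
theorem sub_causalResponse_eq (M : Matrix ι ι ℝ) (B : Matrix ι κ ℝ) (X : ℝ → ι → ℝ)
    (w : κ → ℝ → ℝ)
    (hX : ∀ i r₁ r₂, IntervalIntegrable (fun r => (M *ᵥ X r + B *ᵥ fun j => w j r) i) volume r₁ r₂ ∧
      X r₂ i - X r₁ i = ∫ r in r₁..r₂, (M *ᵥ X r + B *ᵥ fun j => w j r) i)
    {s t : ℝ} (hst : s ≤ t)
    (hs : ∀ k j, IntegrableOn (fun r => (exp (r • M) * B) k j * w j (s - r)) (Set.Ioi 0))
    (ht : ∀ k j, IntegrableOn (fun r => (exp (r • M) * B) k j * w j (t - r)) (Set.Ioi 0)) :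
    X t - causalResponse (fun r => exp (r • M) * B) w t
      = exp ((t - s) • M) *ᵥ (X s - causalResponse (fun r => exp (r • M) * B) w s) := by
  have hd : 0 ≤ t - s := sub_nonneg.2 hst
  ext k
  have hvoc := variation_of_constants M X (fun r => B *ᵥ fun j => w j r) hX s t k
  -- Input older than s: the semigroup law pulls out exp((t - s)M) and leaves the response at time
  -- s.
  have hpast : ∀ j, ∫ r in Set.Ioi (t - s), (exp (r • M) * B) k j * w j (t - r)
      = ∑ l, exp ((t - s) • M) k l *
        ∫ r in Set.Ioi (0 : ℝ), (exp (r • M) * B) l j * w j (s - r) := fun j => by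
    have h1 := (measurePreserving_add_right volume (t - s)).setIntegral_preimage_emb
      (measurableEmbedding_addRight _) (fun r => (exp (r • M) * B) k j * w j (t - r))
      (Set.Ioi (t - s))
    rw [show (· + (t - s)) ⁻¹' Set.Ioi (t - s) = Set.Ioi (0 : ℝ) by ext; simp] at h1
    rw [← h1]
    simp_rw [← integral_const_mul]
    rw [← integral_finsetSum _ fun l _ => (hs l j).const_mul _]
    refine integral_congr_ae (Eventually.of_forall fun r => ?_)
    simp only
    rw [add_comm r, exp_add_smul, Matrix.mul_assoc, mul_apply, Finset.sum_mul]
    refine Finset.sum_congr rfl fun l _ => ?_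
    rw [mul_assoc, show t - (t - s + r) = s - r by ring]
  -- Input since s: exactly the forcing integral of variation of constants, so it cancels in the
  -- deviation.
  have hrecent : ∑ j, ∫ r in (0 : ℝ)..(t - s), (exp (r • M) * B) k j * w j (t - r)
      = ∫ r in s..t, (exp ((t - r) • M) *ᵥ (B *ᵥ fun j => w j r)) k := by
    rw [← intervalIntegral.integral_finsetSum fun j _ => by
      rw [intervalIntegrable_iff_integrableOn_Ioc_of_le hd]
      exact (ht k j).mono_set Set.Ioc_subset_Ioi_self]
    have h1 := intervalIntegral.integral_comp_sub_left (a := s) (b := t)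
      (fun r => ∑ j, (exp (r • M) * B) k j * w j (t - r)) t
    rw [sub_self] at h1
    rw [← h1]
    refine intervalIntegral.integral_congr fun r _ => ?_
    simp only [mulVec_mulVec, sub_sub_cancel]
    rfl
  have hsplit : causalResponse (fun r => exp (r • M) * B) w t k
      = (∫ r in s..t, (exp ((t - r) • M) *ᵥ (B *ᵥ fun j => w j r)) k)
        + (exp ((t - s) • M) *ᵥ causalResponse (fun r => exp (r • M) * B) w s) k := by
    rw [← hrecent]
    have : (exp ((t - s) • M) *ᵥ causalResponse (fun r => exp (r • M) * B) w s) k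
        = ∑ j, ∫ r in Set.Ioi (t - s), (exp (r • M) * B) k j * w j (t - r) := by
      simp_rw [hpast]
      rw [Finset.sum_comm]
      simp [mulVec, dotProduct, causalResponse, Finset.mul_sum]
    rw [this, ← Finset.sum_add_distrib]
    refine Finset.sum_congr rfl fun j _ => ?_
    rw [intervalIntegral.integral_of_le hd, ← setIntegral_union Set.Ioc_disjoint_Ioi_same
      measurableSet_Ioi ((ht k j).mono_set Set.Ioc_subset_Ioi_self)
      ((ht k j).mono_set (Set.Ioi_subset_Ioi hd)), Set.Ioc_union_Ioi_eq_Ioi hd]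
  rw [mulVec_sub, Pi.sub_apply, Pi.sub_apply, hsplit, ← hvoc]
  ring

end VariationOfConstants

/-! ### Bounded two-sided solutions of stable linear recurrences. -/

section BoundedSequences

open Polynomial

/-- The shift on two-sided sequences. -/
def shift : Module.End ℂ (ℤ → ℂ) :=
  LinearMap.funLeft ℂ ℂ fun k : ℤ => k + 1

theorem shift_pow_apply (m : ℕ) (a : ℤ → ℂ) (k : ℤ) : (shift ^ m) a k = a (k + m) := by
  induction m generalizing k with
  | zero => simp
  | succ m ih =>
    rw [pow_succ', Module.End.mul_apply]
    change (shift ^ m) a (k + 1) = _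
    rw [ih]; push_cast; congr 1; ring

/-- Going back m steps gives |a_k| ≤ |ν|^m K for every m; this is where the infinite past is used.
-/
theorem eq_zero_of_shift_eq_smul {ν : ℂ} (hν : ‖ν‖ < 1) {a : ℤ → ℂ} {K : ℝ} (ha : ∀ k, ‖a k‖ ≤ K)
    (h : ∀ k, a (k + 1) = ν * a k) : a = 0 := by
  have h1 : ∀ (m : ℕ) (k : ℤ), a k = ν ^ m * a (k - m) := fun m => by
    induction m with
    | zero => simp
    | succ m ih =>
      intro k
      rw [ih k, pow_succ, mul_assoc, ← h]
      congr 2; push_cast; ring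
  ext k
  have h2 : Tendsto (fun m : ℕ => ‖ν‖ ^ m * K) atTop (𝓝 0) := by
    simpa using (tendsto_pow_atTop_nhds_zero_of_lt_one (norm_nonneg ν) hν).mul_const K
  have h3 : ‖a k‖ ≤ 0 := ge_of_tendsto' h2 fun m => by
    rw [h1 m k, norm_mul, norm_pow]
    exact mul_le_mul_of_nonneg_left (ha _) (by positivity)
  simpa using h3

/-- A bounded two-sided sequence satisfying a linear recurrence, all of whose characteristic roots
lie in the open unit disc, vanishes. -/
theorem eq_zero_of_aeval_shift_eq_zero {p : ℂ[X]} (hp : p.Monic)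
    (hroots : ∀ ν, p.IsRoot ν → ‖ν‖ < 1) {a : ℤ → ℂ} {K : ℝ} (ha : ∀ k, ‖a k‖ ≤ K)
    (h : aeval shift p a = 0) : a = 0 := by
  have main : ∀ s : Multiset ℂ, (∀ ν ∈ s, ‖ν‖ < 1) → ∀ (a : ℤ → ℂ) (K : ℝ), (∀ k, ‖a k‖ ≤ K) →
      aeval shift (s.map fun ν => X - C ν).prod a = 0 → a = 0 := by
    intro s
    induction s using Multiset.induction_on with
    | empty => intro _ a K _ h; simpa using h
    | cons ν s ih =>
      intro hs a K ha h
      rw [Multiset.map_cons, Multiset.prod_cons, mul_comm, map_mul, Module.End.mul_apply] at h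
      have hν : ‖ν‖ < 1 := hs ν (Multiset.mem_cons_self ν s)
      have e : ∀ k, aeval shift (X - C ν) a k = a (k + 1) - ν * a k := fun k => by
        simp [Module.algebraMap_end_apply, shift, LinearMap.funLeft]
      -- The sequence (shift - ν)a is bounded by K + |ν|K and is killed by the remaining factors, so
      -- it vanishes by induction and a is geometric.
      have h0 := ih (fun μ hμ => hs μ (Multiset.mem_cons_of_mem hμ)) _ (K + ‖ν‖ * K) (fun k => by
        rw [e]
        refine (norm_sub_le _ _).trans (add_le_add (ha _) ?_)
        rw [norm_mul]
        exact mul_le_mul_of_nonneg_left (ha _) (norm_nonneg _)) h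
      refine eq_zero_of_shift_eq_smul hν ha fun k => ?_
      have := congrFun h0 k
      rw [e] at this
      exact sub_eq_zero.1 this
  refine main p.roots (fun ν hν => hroots ν (isRoot_of_mem_roots hν)) a K ha ?_
  rw [← (IsAlgClosed.splits p).eq_prod_roots_of_monic hp]
  exact h

theorem IsHurwitz.eq_zero_of_bounded_of_recurrence {ι : Type*} [Fintype ι] [DecidableEq ι]
    {M : Matrix ι ι ℝ} (hM : IsHurwitz M) {a : ℤ → ℝ} {K : ℝ} (ha : ∀ k, |a k| ≤ K)
    (h : ∀ k, ∑ m ∈ Finset.range ((NormedSpace.exp M).charpoly.natDegree + 1),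
      (NormedSpace.exp M).charpoly.coeff m * a (k + m) = 0) : a = 0 := by
  set q := (NormedSpace.exp M).charpoly with hq
  have hc : (fun k => (a k : ℂ)) = 0 := by
    refine eq_zero_of_aeval_shift_eq_zero (p := q.map Complex.ofRealHom)
      ((Matrix.charpoly_monic _).map _) (fun ν hν => hM.norm_lt_one_of_mem_roots hν)
      (K := K) (fun k => by simpa using ha k) ?_
    ext k
    rw [aeval_eq_sum_range, LinearMap.sum_apply, Finset.sum_apply,
      natDegree_map_eq_of_injective Complex.ofRealHom.injective]
    simp only [LinearMap.smul_apply, Pi.smul_apply, shift_pow_apply, coeff_map, smul_eq_mul,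
      Complex.ofRealHom_eq_coe, Pi.zero_apply]
    exact_mod_cast h k
  ext k
  exact Complex.ofReal_eq_zero.1 (congrFun hc k)

end BoundedSequences

/-! ### Second-order theory of filtered processes. -/

section Filtering

/-- The response of the scalar impulse response `f` to the process `v`. -/
noncomputable def filtered {Ω : Type*} (f : ℝ → ℝ) (v : ℝ → Ω → ℝ) (t : ℝ) (o : Ω) : ℝ :=
  ∫ r in Set.Ioi (0 : ℝ), f r * v (t - r) o

theorem filtered_mul_filtered {Ω : Type*} (f g : ℝ → ℝ) (v v' : ℝ → Ω → ℝ) (t t' : ℝ) (o : Ω) :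
    filtered f v t o * filtered g v' t' o =
      ∫ p : ℝ × ℝ, (f p.1 * g p.2) * (v (t - p.1) o * v' (t' - p.2) o)
        ∂((volume.restrict (Set.Ioi 0)).prod (volume.restrict (Set.Ioi 0))) := by
  rw [filtered, filtered, ← integral_prod_mul]
  exact integral_congr_ae (Eventually.of_forall fun p => by ring)

variable {Ω : Type*} [MeasurableSpace Ω] {P : Measure Ω}

/-- Tonelli: the L¹(P) norms of V are uniformly bounded and F is integrable. Every interchange of
expectation and convolution below rests on this. -/
theorem integrable_prod_mul_of_integral_abs_le [SFinite P] {α : Type*} [MeasurableSpace α]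
    {μ : Measure α} [SFinite μ] {F : α → ℝ} (hF : Integrable F μ) {V : α → Ω → ℝ}
    (hV : Measurable (Function.uncurry V)) (hVi : ∀ p, Integrable (V p) P) {K : ℝ}
    (hK : ∀ p, ∫ o, |V p o| ∂P ≤ K) :
    Integrable (fun z : α × Ω => F z.1 * V z.1 z.2) (μ.prod P) := by
  have hm : AEStronglyMeasurable (fun z : α × Ω => F z.1 * V z.1 z.2) (μ.prod P) :=
    hF.aestronglyMeasurable.comp_fst.mul hV.aestronglyMeasurable
  refine (integrable_prod_iff hm).2 ⟨Eventually.of_forall fun p => (hVi p).const_mul (F p), ?_⟩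
  refine (hF.norm.mul_const K).mono' hm.norm.integral_prod_right' (Eventually.of_forall fun p => ?_)
  simp only [norm_mul, integral_const_mul, Real.norm_eq_abs, abs_abs]
  rw [abs_of_nonneg (integral_nonneg fun _ => abs_nonneg _)]
  exact mul_le_mul_of_nonneg_left (hK p) (abs_nonneg _)

theorem integral_abs_mul_le {f g : Ω → ℝ} (hf : MemLp f 2 P) (hg : MemLp g 2 P) :
    ∫ o, |f o * g o| ∂P ≤ (∫ o, f o ^ 2 ∂P + ∫ o, g o ^ 2 ∂P) / 2 := by
  rw [← integral_add hf.integrable_sq hg.integrable_sq, ← integral_div]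
  refine integral_mono (hf.integrable_mul hg).abs
    ((hf.integrable_sq.add hg.integrable_sq).div_const 2) fun o => ?_
  simp only [abs_mul]
  rw [← sq_abs (f o), ← sq_abs (g o)]
  nlinarith [sq_nonneg (|f o| - |g o|)]

section OneProcess

variable [IsProbabilityMeasure P] {v v' : ℝ → Ω → ℝ} {ρ : ℝ} {f g : ℝ → ℝ}

theorem integrable_prod_filtered (hv : Measurable (Function.uncurry v))
    (hv2 : ∀ t, MemLp (v t) 2 P) (hρ : ∀ t, ∫ o, v t o ^ 2 ∂P ≤ ρ)
    (hf : IntegrableOn f (Set.Ioi 0)) (t : ℝ) :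
    Integrable (fun z : ℝ × Ω => f z.1 * v (t - z.1) z.2)
      ((volume.restrict (Set.Ioi 0)).prod P) := by
  -- The constant comes from |v| ≤ (v² + 1)/2 on a probability space.
  refine integrable_prod_mul_of_integral_abs_le (K := (ρ + 1) / 2) hf (V := fun r => v (t - r))
    (hv.comp ((measurable_const.sub measurable_fst).prodMk measurable_snd))
    (fun r => (hv2 _).integrable (by norm_num)) fun r => ?_
  have h := integral_abs_mul_le (hv2 (t - r)) (memLp_const (p := 2) (μ := P) (1 : ℝ))
  simp only [mul_one, one_pow, integral_const, probReal_univ, smul_eq_mul] at h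
  linarith [hρ (t - r)]

/-- A Bochner integral is 0 by default when the integrand is not integrable, so the pathwise
identities need genuine convergence almost surely. -/
theorem ae_integrableOn_filtered (hv : Measurable (Function.uncurry v))
    (hv2 : ∀ t, MemLp (v t) 2 P) (hρ : ∀ t, ∫ o, v t o ^ 2 ∂P ≤ ρ)
    (hf : IntegrableOn f (Set.Ioi 0)) (t : ℝ) :
    ∀ᵐ o ∂P, IntegrableOn (fun r => f r * v (t - r) o) (Set.Ioi 0) :=
  (integrable_prod_filtered hv hv2 hρ hf t).prod_left_ae

theorem integrable_filtered (hv : Measurable (Function.uncurry v))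
    (hv2 : ∀ t, MemLp (v t) 2 P) (hρ : ∀ t, ∫ o, v t o ^ 2 ∂P ≤ ρ)
    (hf : IntegrableOn f (Set.Ioi 0)) (t : ℝ) : Integrable (filtered f v t) P :=
  (integrable_prod_filtered hv hv2 hρ hf t).integral_prod_right

theorem integral_filtered (hv : Measurable (Function.uncurry v))
    (hv2 : ∀ t, MemLp (v t) 2 P) (hρ : ∀ t, ∫ o, v t o ^ 2 ∂P ≤ ρ)
    (hf : IntegrableOn f (Set.Ioi 0)) (t : ℝ) :
    ∫ o, filtered f v t o ∂P = ∫ r in Set.Ioi (0 : ℝ), f r * ∫ o, v (t - r) o ∂P := by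
  have h := integral_integral_swap (f := fun r o => f r * v (t - r) o)
    (integrable_prod_filtered hv hv2 hρ hf t)
  simp only [integral_const_mul] at h
  exact h.symm

theorem integrable_prod_filtered_mul (hv : Measurable (Function.uncurry v))
    (hv2 : ∀ t, MemLp (v t) 2 P) (hρ : ∀ t, ∫ o, v t o ^ 2 ∂P ≤ ρ)
    (hv' : Measurable (Function.uncurry v'))
    (hv2' : ∀ t, MemLp (v' t) 2 P) (hρ' : ∀ t, ∫ o, v' t o ^ 2 ∂P ≤ ρ)
    (hf : IntegrableOn f (Set.Ioi 0)) (hg : IntegrableOn g (Set.Ioi 0)) (t t' : ℝ) :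
    Integrable (fun z : (ℝ × ℝ) × Ω =>
      (f z.1.1 * g z.1.2) * (v (t - z.1.1) z.2 * v' (t' - z.1.2) z.2))
      (((volume.restrict (Set.Ioi 0)).prod (volume.restrict (Set.Ioi 0))).prod P) := by
  refine integrable_prod_mul_of_integral_abs_le (K := ρ) (hf.mul_prod hg)
    (V := fun p o => v (t - p.1) o * v' (t' - p.2) o) (Measurable.mul ?_ ?_)
    (fun p => (hv2 _).integrable_mul (hv2' _)) fun p => ?_
  · exact hv.comp ((measurable_const.sub measurable_fst.fst).prodMk measurable_snd)
  · exact hv'.comp ((measurable_const.sub measurable_fst.snd).prodMk measurable_snd)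
  · have h := integral_abs_mul_le (hv2 (t - p.1)) (hv2' (t' - p.2))
    linarith [hρ (t - p.1), hρ' (t' - p.2)]

theorem integrable_filtered_mul (hv : Measurable (Function.uncurry v))
    (hv2 : ∀ t, MemLp (v t) 2 P) (hρ : ∀ t, ∫ o, v t o ^ 2 ∂P ≤ ρ)
    (hv' : Measurable (Function.uncurry v'))
    (hv2' : ∀ t, MemLp (v' t) 2 P) (hρ' : ∀ t, ∫ o, v' t o ^ 2 ∂P ≤ ρ)
    (hf : IntegrableOn f (Set.Ioi 0)) (hg : IntegrableOn g (Set.Ioi 0)) (t t' : ℝ) :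
    Integrable (fun o => filtered f v t o * filtered g v' t' o) P := by
  simp_rw [filtered_mul_filtered]
  exact (integrable_prod_filtered_mul hv hv2 hρ hv' hv2' hρ' hf hg t t').integral_prod_right

theorem integral_filtered_mul (hv : Measurable (Function.uncurry v))
    (hv2 : ∀ t, MemLp (v t) 2 P) (hρ : ∀ t, ∫ o, v t o ^ 2 ∂P ≤ ρ)
    (hv' : Measurable (Function.uncurry v'))
    (hv2' : ∀ t, MemLp (v' t) 2 P) (hρ' : ∀ t, ∫ o, v' t o ^ 2 ∂P ≤ ρ)
    (hf : IntegrableOn f (Set.Ioi 0)) (hg : IntegrableOn g (Set.Ioi 0)) (t t' : ℝ) :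
    ∫ o, filtered f v t o * filtered g v' t' o ∂P =
      ∫ p : ℝ × ℝ, (f p.1 * g p.2) * (∫ o, v (t - p.1) o * v' (t' - p.2) o ∂P)
        ∂((volume.restrict (Set.Ioi 0)).prod (volume.restrict (Set.Ioi 0))) := by
  simp_rw [filtered_mul_filtered]
  have h := integral_integral_swap
    (f := fun (p : ℝ × ℝ) o => (f p.1 * g p.2) * (v (t - p.1) o * v' (t' - p.2) o))
    (integrable_prod_filtered_mul hv hv2 hρ hv' hv2' hρ' hf hg t t')
  simp only [integral_const_mul] at h
  exact h.symm

theorem memLp_filtered (hv : Measurable (Function.uncurry v))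
    (hv2 : ∀ t, MemLp (v t) 2 P) (hρ : ∀ t, ∫ o, v t o ^ 2 ∂P ≤ ρ)
    (hf : IntegrableOn f (Set.Ioi 0)) (t : ℝ) : MemLp (filtered f v t) 2 P := by
  refine (memLp_two_iff_integrable_sq
    (integrable_filtered hv hv2 hρ hf t).aestronglyMeasurable).2 ?_
  simp_rw [pow_two]
  exact integrable_filtered_mul hv hv2 hρ hv hv2 hρ hf hf t t

end OneProcess

section Input

variable {N : ℕ} {w : Fin N → ℝ → Ω → ℝ}

theorem IsUncorrelatedWSSInput.exists_corr (hw : IsUncorrelatedWSSInput P w) :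
    ∃ R : ℝ → ℝ, ∀ i j s t, ∫ o, w i s o * w j t o ∂P = if i = j then R (t - s) else 0 := by
  obtain ⟨R, hR⟩ := hw.autocorr
  refine ⟨R, fun i j s t => ?_⟩
  split_ifs with h
  · subst h
    rw [← hR i s (t - s), add_sub_cancel]
  · exact hw.uncorrelated i j h s t

variable {R : ℝ → ℝ}

theorem crossCorr_self_eq
    (hR : ∀ i j s t, ∫ o, w i s o * w j t o ∂P = if i = j then R (t - s) else 0) (i : Fin N) :
    crossCorr P (w i) (w i) = R := by
  ext τ
  have h := hR i i (0 - τ) 0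
  rw [if_pos rfl, sub_sub_cancel] at h
  rw [← h, crossCorr, crossCorrAt]
  simp_rw [mul_comm]

/-- Evenness reconciles the lag t + τ in the definition of R with the lag t - τ in `crossCorrAt`. -/
theorem autocorr_neg
    (hR : ∀ i j s t, ∫ o, w i s o * w j t o ∂P = if i = j then R (t - s) else 0) (i : Fin N)
    (τ : ℝ) : R (-τ) = R τ := by
  have h1 := hR i i τ 0
  have h2 := hR i i 0 τ
  rw [if_pos rfl, zero_sub] at h1
  rw [if_pos rfl, sub_zero] at h2
  rw [← h1, ← h2]
  simp_rw [mul_comm]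

theorem IsUncorrelatedWSSInput.stronglyMeasurable_autocorr [SFinite P]
    (hw : IsUncorrelatedWSSInput P w)
    (hR : ∀ i j s t, ∫ o, w i s o * w j t o ∂P = if i = j then R (t - s) else 0) (i : Fin N) :
    StronglyMeasurable R := by
  have : R = fun τ => ∫ o, w i 0 o * w i τ o ∂P := by
    ext τ; rw [hR, if_pos rfl, sub_zero]
  rw [this]
  refine StronglyMeasurable.integral_prod_right (f := fun τ o => w i 0 o * w i τ o) ?_
  exact (((hw.measurable i).comp (measurable_const.prodMk measurable_snd)).mul
    (hw.measurable i)).stronglyMeasurable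

theorem integral_sq_le
    (hR : ∀ i j s t, ∫ o, w i s o * w j t o ∂P = if i = j then R (t - s) else 0) (i : Fin N)
    (t : ℝ) : ∫ o, w i t o ^ 2 ∂P ≤ R 0 := by
  simp_rw [pow_two]
  rw [hR, if_pos rfl, sub_self]

/-- The response of the impulse response matrix `K` to a family of processes, componentwise. -/
noncomputable def filteredSum {ι : Type*} (K : ℝ → Matrix ι (Fin N) ℝ) (w : Fin N → ℝ → Ω → ℝ)
    (i : ι) (t : ℝ) (o : Ω) : ℝ :=
  ∑ j, filtered (fun r => K r i j) (w j) t o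

variable [IsProbabilityMeasure P] {ι : Type*} {K : ℝ → Matrix ι (Fin N) ℝ}

theorem IsUncorrelatedWSSInput.memLp_filteredSum (hw : IsUncorrelatedWSSInput P w)
    (hR : ∀ i j s t, ∫ o, w i s o * w j t o ∂P = if i = j then R (t - s) else 0)
    (hK : ∀ i j, IntegrableOn (fun r => K r i j) (Set.Ioi 0)) (i : ι) (t : ℝ) :
    MemLp (filteredSum K w i t) 2 P :=
  memLp_finsetSum _ fun j _ =>
    memLp_filtered (hw.measurable j) (hw.memLp j) (integral_sq_le hR j) (hK i j) t

theorem IsUncorrelatedWSSInput.integral_filteredSum (hw : IsUncorrelatedWSSInput P w)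
    (hR : ∀ i j s t, ∫ o, w i s o * w j t o ∂P = if i = j then R (t - s) else 0)
    (hK : ∀ i j, IntegrableOn (fun r => K r i j) (Set.Ioi 0)) (i : ι) (t : ℝ) :
    ∫ o, filteredSum K w i t o ∂P = 0 := by
  simp_rw [filteredSum]
  rw [integral_finsetSum _ fun j _ =>
    integrable_filtered (hw.measurable j) (hw.memLp j) (integral_sq_le hR j) (hK i j) t]
  refine Finset.sum_eq_zero fun j _ => ?_
  rw [integral_filtered (hw.measurable j) (hw.memLp j) (integral_sq_le hR j) (hK i j) t]
  simp [hw.mean_zero]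

/-- Uncorrelated inputs leave only the diagonal terms. The right-hand side is free of t, which is
the stationarity of the outputs. -/
theorem IsUncorrelatedWSSInput.integral_filteredSum_mul (hw : IsUncorrelatedWSSInput P w)
    (hR : ∀ i j s t, ∫ o, w i s o * w j t o ∂P = if i = j then R (t - s) else 0)
    (hK : ∀ i j, IntegrableOn (fun r => K r i j) (Set.Ioi 0)) (i j : ι) (t τ : ℝ) :
    ∫ o, filteredSum K w i t o * filteredSum K w j (t - τ) o ∂P =
      ∑ k, ∫ p : ℝ × ℝ, (K p.1 i k * K p.2 j k) * R (τ - (p.1 - p.2))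
        ∂((volume.restrict (Set.Ioi 0)).prod (volume.restrict (Set.Ioi 0))) := by
  simp_rw [filteredSum, Finset.sum_mul_sum]
  have hint : ∀ k l, Integrable (fun o => filtered (fun r => K r i k) (w k) t o *
      filtered (fun r => K r j l) (w l) (t - τ) o) P := fun k l =>
    integrable_filtered_mul (hw.measurable k) (hw.memLp k) (integral_sq_le hR k)
      (hw.measurable l) (hw.memLp l) (integral_sq_le hR l) (hK i k) (hK j l) t (t - τ)
  rw [integral_finsetSum _ fun k _ => integrable_finsetSum _ fun l _ => hint k l]
  refine Finset.sum_congr rfl fun k _ => ?_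
  rw [integral_finsetSum _ fun l _ => hint k l, Finset.sum_eq_single k]
  · rw [integral_filtered_mul (hw.measurable k) (hw.memLp k) (integral_sq_le hR k)
      (hw.measurable k) (hw.memLp k) (integral_sq_le hR k) (hK i k) (hK j k) t (t - τ)]
    refine integral_congr_ae (Eventually.of_forall fun p => ?_)
    simp only
    -- The lag is (t - τ - p.2) - (t - p.1) = -(τ - (p.1 - p.2)).
    rw [hR, if_pos rfl, ← autocorr_neg hR k]
    congr 2; ring
  · intro l _ hl
    rw [integral_filtered_mul (hw.measurable k) (hw.memLp k) (integral_sq_le hR k)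
      (hw.measurable l) (hw.memLp l) (integral_sq_le hR l) (hK i k) (hK j l) t (t - τ)]
    simp [hR, Ne.symm hl]
  · exact fun h => absurd (Finset.mem_univ k) h

end Input

end Filtering

/-! ### Fourier transforms of mixtures of translates. -/

section Fourier

theorem norm_cexp_neg_I_mul (x y : ℝ) :
    ‖Complex.exp (-(Complex.I * (x : ℂ) * (y : ℂ)))‖ = 1 := by
  rw [Complex.norm_exp]; simp

theorem integrable_mul_cexp {f : ℝ → ℝ} (hf : Integrable f) (ω : ℝ) :
    Integrable fun τ : ℝ => (f τ : ℂ) * Complex.exp (-(Complex.I * (ω : ℂ) * (τ : ℂ))) :=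
  hf.ofReal.mul_bdd (c := 1) (Continuous.aestronglyMeasurable (by fun_prop))
    (Eventually.of_forall fun τ => (norm_cexp_neg_I_mul ω τ).le)

theorem angularFourier_finset_sum {κ : Type*} (s : Finset κ) (f : κ → ℝ → ℝ)
    (hf : ∀ k, Integrable (f k)) (ω : ℝ) :
    angularFourier (fun τ => ∑ k ∈ s, f k τ) ω = ∑ k ∈ s, angularFourier (f k) ω := by
  simp only [angularFourier]
  rw [← integral_finsetSum _ fun k _ => integrable_mul_cexp (hf k) ω]
  refine integral_congr_ae (Eventually.of_forall fun τ => ?_)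
  simp only
  rw [Complex.ofReal_sum, Finset.sum_mul]

variable {α : Type*} [MeasurableSpace α] {μ : Measure α} [SFinite μ] {F : α → ℝ} {φ : α → ℝ}
  {R : ℝ → ℝ}

theorem integrable_prod_mul_comp_sub (hF : Integrable F μ) (hφ : Measurable φ)
    (hRm : StronglyMeasurable R) (hR : Integrable R) :
    Integrable (fun z : ℝ × α => F z.2 * R (z.1 - φ z.2)) (volume.prod μ) := by
  have hm : AEStronglyMeasurable (fun z : ℝ × α => F z.2 * R (z.1 - φ z.2)) (volume.prod μ) :=
    hF.aestronglyMeasurable.comp_snd.mul (hRm.comp_measurable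
      (measurable_fst.sub (hφ.comp measurable_snd))).aestronglyMeasurable
  refine (integrable_prod_iff' hm).2 ⟨Eventually.of_forall fun p =>
    (hR.comp_sub_right (φ p)).const_mul (F p), ?_⟩
  have : (fun p => ∫ τ, ‖F p * R (τ - φ p)‖) = fun p => ‖F p‖ * ∫ τ, ‖R τ‖ := by
    ext p
    simp only [norm_mul, integral_const_mul]
    rw [integral_sub_right_eq_self fun τ => ‖R τ‖]
  simp only [this]
  exact hF.norm.mul_const _

theorem integrable_integral_mul_comp_sub (hF : Integrable F μ) (hφ : Measurable φ)
    (hRm : StronglyMeasurable R) (hR : Integrable R) :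
    Integrable fun τ => ∫ p, F p * R (τ - φ p) ∂μ :=
  (integrable_prod_mul_comp_sub hF hφ hRm hR).integral_prod_left

/-- Translating R by φ p multiplies its transform by a phase; Fubini then averages the phases
against F. -/
theorem angularFourier_integral_mul_comp_sub (hF : Integrable F μ) (hφ : Measurable φ)
    (hRm : StronglyMeasurable R) (hR : Integrable R) (ω : ℝ) :
    angularFourier (fun τ => ∫ p, F p * R (τ - φ p) ∂μ) ω =
      (∫ p, (F p : ℂ) * Complex.exp (-(Complex.I * ω * φ p)) ∂μ) * angularFourier R ω := by
  have hint : Integrable (fun z : ℝ × α => ((F z.2 * R (z.1 - φ z.2) : ℝ) : ℂ) *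
      Complex.exp (-(Complex.I * (ω : ℂ) * (z.1 : ℂ)))) (volume.prod μ) :=
    (integrable_prod_mul_comp_sub hF hφ hRm hR).ofReal.mul_bdd (c := 1)
      (Measurable.aestronglyMeasurable (by fun_prop))
      (Eventually.of_forall fun z => (norm_cexp_neg_I_mul ω z.1).le)
  have hswap := integral_integral_swap (f := fun (τ : ℝ) p => ((F p * R (τ - φ p) : ℝ) : ℂ) *
      Complex.exp (-(Complex.I * (ω : ℂ) * (τ : ℂ)))) hint
  rw [angularFourier]
  simp_rw [integral_mul_const, integral_complex_ofReal] at hswap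
  rw [hswap, ← integral_mul_const]
  refine integral_congr_ae (Eventually.of_forall fun p => ?_)
  simp only
  rw [angularFourier, mul_assoc, ← integral_const_mul, ← integral_const_mul,
    ← integral_add_right_eq_self _ (φ p)]
  refine integral_congr_ae (Eventually.of_forall fun τ => ?_)
  simp only [add_sub_cancel_right]
  push_cast
  rw [mul_add, neg_add, Complex.exp_add]
  ring

end Fourier

/-! ### The stacked network and its transfer matrix. -/

section Network

variable {N n : ℕ}

/-- The output matrix `I ⊗ cᵀ` of the network. -/
def outputMatrix (N : ℕ) (c : Fin n → ℝ) : Matrix (Fin N) (Fin N × Fin n) ℝ :=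
  Matrix.of fun i p => if i = p.1 then c p.2 else 0

/-- The input matrix `I ⊗ b` of the network. -/
def inputMatrix (N : ℕ) (b : Fin n → ℝ) : Matrix (Fin N × Fin n) (Fin N) ℝ :=
  Matrix.of fun p j => if p.1 = j then b p.2 else 0

theorem outputMatrix_mulVec (c : Fin n → ℝ) (X : Fin N × Fin n → ℝ) (i : Fin N) :
    (outputMatrix N c *ᵥ X) i = c ⬝ᵥ fun k => X (i, k) := by
  simp [outputMatrix, mulVec, dotProduct, Fintype.sum_prod_type]

theorem inputMatrix_mulVec (b : Fin n → ℝ) (v : Fin N → ℝ) (p : Fin N × Fin n) :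
    (inputMatrix N b *ᵥ v) p = b p.2 * v p.1 := by
  simp [inputMatrix, mulVec, dotProduct]

theorem networkMatrix_mulVec (A : Matrix (Fin n) (Fin n) ℝ) (b c : Fin n → ℝ)
    (G : Matrix (Fin N) (Fin N) ℝ) (X : Fin N × Fin n → ℝ) (i : Fin N) (k : Fin n) :
    (networkMatrix A b c G *ᵥ X) (i, k) =
      (A *ᵥ fun l => X (i, l)) k + (∑ j, G i j * (c ⬝ᵥ fun l => X (j, l))) * b k := by
  simp only [networkMatrix, mulVec, dotProduct, Fintype.sum_prod_type, Matrix.add_apply,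
    kroneckerMap_apply, one_apply, vecMulVec_apply, add_mul, Finset.sum_add_distrib]
  congr 1
  · simp [Finset.sum_ite_eq]
  · rw [Finset.sum_mul]
    refine Finset.sum_congr rfl fun j _ => ?_
    rw [Finset.mul_sum, Finset.sum_mul]
    exact Finset.sum_congr rfl fun l _ => by ring

theorem nodeField_eq {Ω : Type*} (A : Matrix (Fin n) (Fin n) ℝ) (b c : Fin n → ℝ)
    (G : Matrix (Fin N) (Fin N) ℝ) (w : Fin N → ℝ → Ω → ℝ) (x : Fin N → ℝ → Ω → Fin n → ℝ)
    (p : Fin N × Fin n) (t : ℝ) (o : Ω) :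
    nodeField A b c G w x p.1 t o p.2 =
      (networkMatrix A b c G *ᵥ (fun q => x q.1 t o q.2)
        + inputMatrix N b *ᵥ fun j => w j t o) p := by
  obtain ⟨i, k⟩ := p
  rw [Pi.add_apply, networkMatrix_mulVec, inputMatrix_mulVec]
  simp only [nodeField, output, Pi.add_apply, Pi.smul_apply, smul_eq_mul]
  ring

/-- The complex network transfer matrix, computed from a left inverse `Q` of the resolvent matrix
`s I - M`, satisfies `(I - h G) H = h I`. -/
theorem transfer_identity (A : Matrix (Fin n) (Fin n) ℝ) (b c : Fin n → ℝ)
    (G : Matrix (Fin N) (Fin N) ℝ) (s : ℂ) (hA : IsUnit (resolventMatrix A s).det)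
    (Q : Matrix (Fin N × Fin n) (Fin N × Fin n) ℂ)
    (hQ : Q * (s • (1 : Matrix (Fin N × Fin n) (Fin N × Fin n) ℂ)
      - (networkMatrix A b c G).map (fun r : ℝ => (r : ℂ))) = 1) :
    (1 - nodalTransfer A b c s • G.map (fun r : ℝ => (r : ℂ))) *
      ((outputMatrix N c).map (fun r : ℝ => (r : ℂ)) * Q *
        (inputMatrix N b).map (fun r : ℝ => (r : ℂ))) = nodalTransfer A b c s • 1 := by
  set h := nodalTransfer A b c s with hh
  set Cc := (outputMatrix N c).map (fun r : ℝ => (r : ℂ)) with hCc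
  set Bc := (inputMatrix N b).map (fun r : ℝ => (r : ℂ)) with hBc
  set Gc := G.map (fun r : ℝ => (r : ℂ)) with hGc
  have hQ' := mul_eq_one_comm.1 hQ
  set Y := Q * Bc with hY
  have hYeq : (s • (1 : Matrix (Fin N × Fin n) (Fin N × Fin n) ℂ)
      - (networkMatrix A b c G).map (fun r : ℝ => (r : ℂ))) * Y = Bc := by
    rw [hY, ← Matrix.mul_assoc, hQ', Matrix.one_mul]
  have hCY : ∀ i j, (Cc * Y) i j = ∑ k, (c k : ℂ) * Y (i, k) j := fun i j => by
    simp [hCc, outputMatrix, mul_apply, Fintype.sum_prod_type, apply_ite, ite_mul]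
  -- Block row i of (sI - M)Y = B. Since the coupling has the form G ⊗ bcᵀ, the other nodes enter
  -- only through Cc * Y and only along b.
  have hnode : ∀ i j k, (resolventMatrix A s *ᵥ fun l => Y (i, l) j) k
      = (b k : ℂ) * ((1 : Matrix (Fin N) (Fin N) ℂ) i j + (Gc * (Cc * Y)) i j) := fun i j k => by
    have e := congrFun (congrFun hYeq (i, k)) j
    rw [Matrix.sub_mul, Matrix.smul_mul, Matrix.one_mul, Matrix.sub_apply, Matrix.smul_apply,
      mul_apply, Fintype.sum_prod_type] at e
    have e1 : ∑ i', ∑ l, (networkMatrix A b c G).map (fun r : ℝ => (r : ℂ)) (i, k) (i', l)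
          * Y (i', l) j
        = ∑ l, (A k l : ℂ) * Y (i, l) j + (b k : ℂ) * (Gc * (Cc * Y)) i j := by
      simp only [networkMatrix, map_apply, Matrix.add_apply, kroneckerMap_apply, one_apply,
        vecMulVec_apply, Complex.ofReal_add, Complex.ofReal_mul, add_mul, Finset.sum_add_distrib]
      congr 1
      · simp [apply_ite, ite_mul]
      · rw [mul_apply, Finset.mul_sum]
        refine Finset.sum_congr rfl fun i' _ => ?_
        rw [hCY, hGc, map_apply, Finset.mul_sum, Finset.mul_sum]
        exact Finset.sum_congr rfl fun l _ => by ring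
    have e2 : Bc (i, k) j = (b k : ℂ) * (1 : Matrix (Fin N) (Fin N) ℂ) i j := by
      by_cases hij : i = j <;> simp [hBc, inputMatrix, one_apply, hij]
    rw [e1, e2] at e
    have e3 : (resolventMatrix A s *ᵥ fun l => Y (i, l) j) k
        = s • Y (i, k) j - ∑ l, (A k l : ℂ) * Y (i, l) j := by
      rw [resolventMatrix, sub_mulVec, smul_mulVec, one_mulVec]
      rfl
    rw [e3]
    linear_combination e
  have hsol : ∀ i j, (fun l => Y (i, l) j)
      = ((1 : Matrix (Fin N) (Fin N) ℂ) i j + (Gc * (Cc * Y)) i j) •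
        ((resolventMatrix A s)⁻¹ *ᵥ fun k => (b k : ℂ)) := fun i j => by
    have e : resolventMatrix A s *ᵥ (fun l => Y (i, l) j)
        = ((1 : Matrix (Fin N) (Fin N) ℂ) i j + (Gc * (Cc * Y)) i j) • fun k => (b k : ℂ) := by
      ext k
      rw [hnode, Pi.smul_apply, smul_eq_mul, mul_comm]
    rw [← mulVec_smul, ← e, mulVec_mulVec, nonsing_inv_mul _ hA, one_mulVec]
  have hH : ∀ i j, (Cc * Y) i j
      = h * ((1 : Matrix (Fin N) (Fin N) ℂ) i j + (Gc * (Cc * Y)) i j) := fun i j => by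
    have e : (Cc * Y) i j = (fun k => (c k : ℂ)) ⬝ᵥ fun l => Y (i, l) j := hCY i j
    rw [e, hsol, dotProduct_smul, smul_eq_mul, mul_comm]
    rfl
  rw [Matrix.mul_assoc, Matrix.sub_mul, Matrix.one_mul, Matrix.smul_mul]
  ext i j
  rw [Matrix.sub_apply, Matrix.smul_apply, Matrix.smul_apply]
  simp only [smul_eq_mul]
  linear_combination hH i j

end Network

/-! ### Recovering the input density from an eigenpair. -/

section SpectralAlgebra

variable {ι : Type*} [Fintype ι] [DecidableEq ι]

/-- If `(I - h G) H = h I` and `S = σ H Hᴴ`, an eigenpair `(λ, u)` of `G` determines `σ`. -/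
theorem eigenpair_determines_psd (G : Matrix ι ι ℝ) (H S : Matrix ι ι ℂ) (h σ : ℂ) (hh : h ≠ 0)
    (hσ : σ ≠ 0) (hH : (1 - h • G.map (fun r : ℝ => (r : ℂ))) * H = h • 1)
    (hS : S = σ • (H * Hᴴ)) (lam : ℝ) (u : ι → ℝ) (hGu : G *ᵥ u = lam • u) (hu : u ⬝ᵥ u = 1) :
    IsUnit S.det ∧ (fun k => (u k : ℂ)) ⬝ᵥ (S⁻¹ *ᵥ fun k => (u k : ℂ)) ≠ 0 ∧
      σ = ((lam ^ 2 * ‖h‖ ^ 2 - 2 * lam * h.re + 1 : ℝ) : ℂ) /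
        (((fun k => (u k : ℂ)) ⬝ᵥ (S⁻¹ *ᵥ fun k => (u k : ℂ))) * ((‖h‖ ^ 2 : ℝ) : ℂ)) := by
  set uc : ι → ℂ := fun k => (u k : ℂ) with huc
  set T := 1 - h • G.map (fun r : ℝ => (r : ℂ)) with hT
  have hGuc : G.map (fun r : ℝ => (r : ℂ)) *ᵥ uc = (lam : ℂ) • uc := by
    ext k
    have := congrArg (fun r : ℝ => (r : ℂ)) (congrFun hGu k)
    simpa [mulVec, dotProduct, huc] using this
  have hTu : T *ᵥ uc = (1 - h * lam) • uc := by
    rw [hT, sub_mulVec, one_mulVec, smul_mulVec, hGuc, smul_smul, sub_smul, one_smul]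
  have hustar : star uc = uc := by ext k; simp [huc]
  have huu : uc ⬝ᵥ uc = 1 := by
    have := congrArg (fun r : ℝ => (r : ℂ)) hu
    simpa [dotProduct, huc] using this
  have huT : uc ᵥ* Tᴴ = (star (1 - h * lam)) • uc := by
    have := congrArg star hTu
    rwa [star_mulVec, star_smul, hustar] at this
  have hne : star h * h ≠ 0 := mul_ne_zero (star_ne_zero.2 hh) hh
  -- A one-sided inverse of a square matrix is two-sided, so T and H commute.
  have hHT : H * T = h • 1 := by
    have e1 : T * (h⁻¹ • H) = 1 := by
      rw [Matrix.mul_smul, hH, smul_smul, inv_mul_cancel₀ hh, one_smul]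
    have e2 := mul_eq_one_comm.1 e1
    rw [Matrix.smul_mul] at e2
    rw [← e2, smul_smul, mul_inv_cancel₀ hh, one_smul]
  have hinv : (σ⁻¹ * (star h * h)⁻¹) • (Tᴴ * T) * S = 1 := by
    have e1 : Tᴴ * T * (H * Hᴴ) = (star h * h) • 1 := by
      have e2 : Tᴴ * T * (H * Hᴴ) = Tᴴ * (T * H) * Hᴴ := by simp only [Matrix.mul_assoc]
      have e3 : Tᴴ * Hᴴ = star h • 1 := by
        rw [← conjTranspose_mul, hHT, conjTranspose_smul, conjTranspose_one]
      rw [e2, hH, Matrix.mul_smul, Matrix.mul_one, Matrix.smul_mul, e3, smul_smul, mul_comm]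
    rw [hS, Matrix.smul_mul, Matrix.mul_smul, e1, smul_smul, smul_smul]
    rw [mul_right_comm σ⁻¹, inv_mul_cancel₀ hσ, one_mul, inv_mul_cancel₀ hne, one_smul]
  have hSinv : S⁻¹ = (σ⁻¹ * (star h * h)⁻¹) • (Tᴴ * T) := inv_eq_left_inv hinv
  have hdet : IsUnit S.det := (isUnit_iff_isUnit_det _).1 (IsUnit.of_mul_eq_one_right _ hinv)
  have hq : uc ⬝ᵥ (S⁻¹ *ᵥ uc) = σ⁻¹ * (star h * h)⁻¹ * (star (1 - h * lam) * (1 - h * lam)) := by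
    rw [hSinv, smul_mulVec, dotProduct_smul, ← mulVec_mulVec, dotProduct_mulVec, huT, hTu,
      smul_dotProduct, dotProduct_smul, huu]
    simp only [smul_eq_mul]
    ring
  -- If 1 - hλ = 0 then Tu = 0, hence hu = HTu = 0, contradicting uᵀu = 1.
  have hz : 1 - h * lam ≠ 0 := fun h0 => by
    have e1 : (H * T) *ᵥ uc = 0 := by rw [← mulVec_mulVec, hTu, h0, zero_smul, mulVec_zero]
    rw [hHT, smul_mulVec, one_mulVec] at e1
    have e2 : uc = 0 := (smul_eq_zero.1 e1).resolve_left hh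
    rw [e2] at huu
    simp at huu
  have hqne : σ⁻¹ * (star h * h)⁻¹ * (star (1 - h * lam) * (1 - h * lam)) ≠ 0 :=
    mul_ne_zero (mul_ne_zero (inv_ne_zero hσ) (inv_ne_zero hne))
      (mul_ne_zero (star_ne_zero.2 hz) hz)
  have hnum : ((lam ^ 2 * ‖h‖ ^ 2 - 2 * lam * h.re + 1 : ℝ) : ℂ)
      = star (1 - h * lam) * (1 - h * lam) := by
    rw [Complex.sq_norm, Complex.normSq_apply]
    apply Complex.ext <;> simp [pow_two] <;> ring
  have hden : ((‖h‖ ^ 2 : ℝ) : ℂ) = star h * h := by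
    rw [Complex.star_def, mul_comm, Complex.mul_conj, Complex.sq_norm]
  refine ⟨hdet, hq ▸ hqne, ?_⟩
  rw [hq, hnum, hden]
  have hz' := mul_ne_zero (star_ne_zero.2 hz) hz
  generalize star (1 - h * lam) * (1 - h * lam) = q at *
  generalize star h * h = d at *
  field_simp

end SpectralAlgebra

/-! ### Bounded output power forces the causal response; spectra of the outputs. -/

section SteadyState

variable {Ω : Type*} [MeasurableSpace Ω] {P : Measure Ω}

/-- An observable of a process with stable free dynamics vanishes if its power is bounded on the
whole time axis. -/
theorem IsHurwitz.ae_eq_zero_of_bounded_power {ι : Type*} [Fintype ι] [DecidableEq ι]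
    {M : Matrix ι ι ℝ} (hM : IsHurwitz M) (D : ℝ → Ω → ι → ℝ)
    (hD : ∀ s t, s ≤ t → ∀ᵐ o ∂P, D t o = exp ((t - s) • M) *ᵥ D s o) (c : ι → ℝ)
    (z : ℝ → Ω → ℝ) (hz : ∀ t, ∀ᵐ o ∂P, z t o = c ⬝ᵥ D t o) (hz2 : ∀ t, MemLp (z t) 2 P)
    (K : ℝ) (hK : ∀ t, ∫ o, z t o ^ 2 ∂P ≤ K) (t : ℝ) : ∀ᵐ o ∂P, z t o = 0 := by
  set q := (exp M).charpoly with hq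
  have hcay : ∑ m ∈ Finset.range (q.natDegree + 1), q.coeff m • (exp M) ^ m = 0 := by
    rw [← Polynomial.aeval_eq_sum_range, hq, Matrix.aeval_self_charpoly]
  have hrec : ∀ s, ∀ᵐ o ∂P, ∑ m ∈ Finset.range (q.natDegree + 1),
      q.coeff m * z (s + m) o = 0 := fun s => by
    filter_upwards [ae_all_iff.2 fun m : ℕ => hz (s + m),
      ae_all_iff.2 fun m : ℕ => hD s (s + m) (by simp)] with o h1 h2
    have h3 : ∀ m : ℕ, z (s + m) o = c ⬝ᵥ ((exp M) ^ m *ᵥ D s o) := fun m => by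
      rw [h1, h2, add_sub_cancel_left, Nat.cast_smul_eq_nsmul, Matrix.exp_nsmul]
    have h4 : ∑ m ∈ Finset.range (q.natDegree + 1), q.coeff m * z (s + m) o
        = c ⬝ᵥ ((∑ m ∈ Finset.range (q.natDegree + 1), q.coeff m • (exp M) ^ m) *ᵥ D s o) := by
      rw [sum_mulVec, dotProduct_sum]
      exact Finset.sum_congr rfl fun m _ => by
        rw [h3, smul_mulVec, dotProduct_smul, smul_eq_mul]
    rw [h4, hcay, zero_mulVec, dotProduct_zero]
  have hint : ∀ s, Integrable (fun o => z s o * z t o) P := fun s => (hz2 s).integrable_mul (hz2 t)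
  -- Correlating with the fixed variable z(t) turns the almost sure recurrence into one for a
  -- deterministic sequence, bounded by K through |ab| ≤ (a² + b²)/2.
  have h0 := hM.eq_zero_of_bounded_of_recurrence
    (a := fun k : ℤ => ∫ o, z (t + k) o * z t o ∂P) (K := K) (fun k => by
      refine abs_integral_le_integral_abs.trans ((integral_abs_mul_le (hz2 _) (hz2 _)).trans ?_)
      linarith [hK (t + k), hK t]) (fun k => by
      simp_rw [← integral_const_mul]
      rw [← integral_finsetSum _ fun m _ => (hint _).const_mul _]
      refine integral_eq_zero_of_ae ?_
      filter_upwards [hrec (t + k)] with o ho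
      simp_rw [← mul_assoc]
      rw [← Finset.sum_mul]
      push_cast
      simp_rw [← add_assoc]
      rw [ho, zero_mul]
      rfl)
  have h1 := congrFun h0 0
  simp only [Int.cast_zero, add_zero, Pi.zero_apply] at h1
  have h2 := (integral_eq_zero_iff_of_nonneg (fun o => mul_self_nonneg (z t o)) (hint t)).1 h1
  filter_upwards [h2] with o ho
  exact mul_self_eq_zero.1 ho

variable {N n : ℕ} {A : Matrix (Fin n) (Fin n) ℝ} {b c : Fin n → ℝ} {G : Matrix (Fin N) (Fin N) ℝ}

/-- The impulse response matrix of the network. -/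
noncomputable def impulseResponse (A : Matrix (Fin n) (Fin n) ℝ) (b c : Fin n → ℝ)
    (G : Matrix (Fin N) (Fin N) ℝ) (r : ℝ) : Matrix (Fin N) (Fin N) ℝ :=
  outputMatrix N c * (exp (r • networkMatrix A b c G) * inputMatrix N b)

theorem integrableOn_exp_mul_inputMatrix (hM : IsHurwitz (networkMatrix A b c G))
    (p : Fin N × Fin n) (j : Fin N) :
    IntegrableOn (fun r : ℝ => (exp (r • networkMatrix A b c G) * inputMatrix N b) p j)
      (Set.Ioi 0) := by
  simp_rw [mul_apply]
  exact integrable_finsetSum _ fun q _ => (hM.integrableOn_exp p q).mul_const _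

theorem integrableOn_impulseResponse (hM : IsHurwitz (networkMatrix A b c G)) (i j : Fin N) :
    IntegrableOn (fun r => impulseResponse A b c G r i j) (Set.Ioi 0) := by
  simp_rw [impulseResponse, mul_apply (M := outputMatrix N c)]
  exact integrable_finsetSum _ fun p _ => (integrableOn_exp_mul_inputMatrix hM p j).const_mul _

variable {w : Fin N → ℝ → Ω → ℝ} {x : Fin N → ℝ → Ω → Fin n → ℝ}

theorem IsNetworkSolution.ae_stacked (hx : IsNetworkSolution P A b c G w x) :
    ∀ᵐ o ∂P, ∀ (p : Fin N × Fin n) r₁ r₂,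
      IntervalIntegrable (fun r => (networkMatrix A b c G *ᵥ (fun q => x q.1 r o q.2)
        + inputMatrix N b *ᵥ fun j => w j r o) p) volume r₁ r₂ ∧
      x p.1 r₂ o p.2 - x p.1 r₁ o p.2 =
        ∫ r in r₁..r₂, (networkMatrix A b c G *ᵥ (fun q => x q.1 r o q.2)
          + inputMatrix N b *ᵥ fun j => w j r o) p := by
  filter_upwards [hx.ode] with o ho p r₁ r₂
  obtain ⟨h1, h2⟩ := ho p.1 r₁ r₂
  simp_rw [← nodeField_eq]
  have h3 := (ContinuousLinearMap.proj (R := ℝ) (φ := fun _ : Fin n => ℝ)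
    p.2).intervalIntegral_comp_comm h1
  simp only [ContinuousLinearMap.proj_apply] at h3
  refine ⟨⟨h1.1.eval p.2, h1.2.eval p.2⟩, ?_⟩
  rw [h3, ← h2, Pi.sub_apply]

/-- In steady state the outputs are the causal responses to the inputs. -/
theorem ae_output_eq_filteredSum [IsProbabilityMeasure P]
    (hM : IsHurwitz (networkMatrix A b c G)) (hw : IsUncorrelatedWSSInput P w) {R : ℝ → ℝ}
    (hR : ∀ i j s t, ∫ o, w i s o * w j t o ∂P = if i = j then R (t - s) else 0)
    (hx : IsNetworkSolution P A b c G w x) (hy : HasBoundedPower P (output c x)) (i : Fin N)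
    (t : ℝ) :
    ∀ᵐ o ∂P, output c x i t o = filteredSum (impulseResponse A b c G) w i t o := by
  set M := networkMatrix A b c G with hMdef
  obtain ⟨K, hK⟩ := hy
  have hKi := integrableOn_impulseResponse hM
  have hwi : ∀ t, ∀ᵐ o ∂P, ∀ p j,
      IntegrableOn (fun r => (exp (r • M) * inputMatrix N b) p j * w j (t - r) o) (Set.Ioi 0) :=
    fun t => ae_all_iff.2 fun p => ae_all_iff.2 fun j =>
      ae_integrableOn_filtered (hw.measurable j) (hw.memLp j) (integral_sq_le hR j)
        (integrableOn_exp_mul_inputMatrix hM p j) t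
  set D : ℝ → Ω → Fin N × Fin n → ℝ := fun t o => (fun p => x p.1 t o p.2)
    - causalResponse (fun r => exp (r • M) * inputMatrix N b) (fun j t => w j t o) t with hDdef
  have hD : ∀ s t, s ≤ t → ∀ᵐ o ∂P, D t o = exp ((t - s) • M) *ᵥ D s o := fun s t hst => by
    filter_upwards [hwi s, hwi t, hx.ae_stacked] with o hs ht ho
    exact sub_causalResponse_eq M (inputMatrix N b) (fun t p => x p.1 t o p.2)
      (fun j t => w j t o) ho hst hs ht
  have hz : ∀ t, ∀ᵐ o ∂P, output c x i t o - filteredSum (impulseResponse A b c G) w i t o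
      = outputMatrix N c i ⬝ᵥ D t o := fun t => by
    filter_upwards [hwi t] with o ho
    rw [hDdef, dotProduct_sub]
    congr 1
    · exact (outputMatrix_mulVec c (fun p => x p.1 t o p.2) i).symm
    · simp only [filteredSum, filtered, impulseResponse, causalResponse, dotProduct,
        Finset.mul_sum]
      rw [Finset.sum_comm]
      refine Finset.sum_congr rfl fun j _ => ?_
      simp_rw [← integral_const_mul]
      rw [← integral_finsetSum _ fun p _ => (ho p j).const_mul _]
      refine integral_congr_ae (Eventually.of_forall fun r => ?_)
      simp only
      rw [mul_apply, Finset.sum_mul]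
      exact Finset.sum_congr rfl fun p _ => mul_assoc _ _ _
  have hf2 := hw.memLp_filteredSum hR hKi i
  -- The causal response has constant power, so the difference has bounded power by (a - b)² ≤ 2a² +
  -- 2b².
  have hpow : ∀ t, ∫ o, filteredSum (impulseResponse A b c G) w i t o ^ 2 ∂P
      = ∫ o, filteredSum (impulseResponse A b c G) w i 0 o ^ 2 ∂P := fun t => by
    have h1 := hw.integral_filteredSum_mul hR hKi i i t 0
    rw [← hw.integral_filteredSum_mul hR hKi i i 0 0] at h1
    simpa only [sub_zero, ← pow_two] using h1
  have hzero := hM.ae_eq_zero_of_bounded_power D hD (outputMatrix N c i) _ hz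
    (fun t => (hK i t).1.sub (hf2 t))
    (2 * K + 2 * ∫ o, filteredSum (impulseResponse A b c G) w i 0 o ^ 2 ∂P) (fun t => by
      rw [← hpow t]
      have h1 : ∫ o, (output c x i t o - filteredSum (impulseResponse A b c G) w i t o) ^ 2 ∂P
          ≤ ∫ o, (2 * output c x i t o ^ 2
            + 2 * filteredSum (impulseResponse A b c G) w i t o ^ 2) ∂P := by
        refine integral_mono ((hK i t).1.sub (hf2 t)).integrable_sq
          (((hK i t).1.integrable_sq.const_mul 2).add ((hf2 t).integrable_sq.const_mul 2))
          fun o => ?_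
        simp only
        nlinarith [sq_nonneg (output c x i t o + filteredSum (impulseResponse A b c G) w i t o)]
      rw [integral_add ((hK i t).1.integrable_sq.const_mul 2)
        ((hf2 t).integrable_sq.const_mul 2), integral_const_mul, integral_const_mul] at h1
      linarith [(hK i t).2]) t
  filter_upwards [hzero] with o ho
  exact sub_eq_zero.1 ho

/-- The network transfer matrix at `jω`. -/
noncomputable def transferMatrix (A : Matrix (Fin n) (Fin n) ℝ) (b c : Fin n → ℝ)
    (G : Matrix (Fin N) (Fin N) ℝ) (ω : ℝ) : Matrix (Fin N) (Fin N) ℂ :=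
  Matrix.of fun i j => ∫ r : ℝ in Set.Ioi 0,
    (impulseResponse A b c G r i j : ℂ) * Complex.exp (-(Complex.I * ω * r))

theorem transferMatrix_identity (hM : IsHurwitz (networkMatrix A b c G)) (ω : ℝ)
    (hA : IsUnit (resolventMatrix A (Complex.I * ω)).det) :
    (1 - nodalTransfer A b c (Complex.I * ω) • G.map (fun r : ℝ => (r : ℂ))) *
      transferMatrix A b c G ω = nodalTransfer A b c (Complex.I * ω) • 1 := by
  rw [← transfer_identity A b c G (Complex.I * ω) hA _ (hM.resolvent_mul_integral ω)]
  congr 1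
  have hint : ∀ p q, IntegrableOn (fun r : ℝ => (exp (r • networkMatrix A b c G) p q : ℂ) *
      Complex.exp (-(Complex.I * ω * r))) (Set.Ioi 0) := fun p q =>
    (hM.integrableOn_exp p q).ofReal.mul_bdd (c := 1)
      (Continuous.aestronglyMeasurable (by fun_prop))
      (Eventually.of_forall fun r => (norm_cexp_neg_I_mul ω r).le)
  ext i j
  rw [Matrix.mul_assoc, mul_apply]
  simp_rw [mul_apply, of_apply, map_apply]
  simp_rw [← integral_mul_const]
  simp_rw [← integral_finsetSum _ fun q _ => (hint _ q).mul_const _, ← integral_const_mul]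
  rw [← integral_finsetSum _ fun p _ =>
    (integrable_finsetSum _ fun q _ => (hint p q).mul_const _).const_mul _]
  rw [transferMatrix, of_apply]
  refine integral_congr_ae (Eventually.of_forall fun r => ?_)
  simp only [impulseResponse, mul_apply, Complex.ofReal_sum, Complex.ofReal_mul, Finset.sum_mul,
    Finset.mul_sum]
  exact Finset.sum_congr rfl fun p _ => Finset.sum_congr rfl fun q _ => by ring

variable [IsProbabilityMeasure P]

theorem crossCorrAt_output_eq
    (hM : IsHurwitz (networkMatrix A b c G)) (hw : IsUncorrelatedWSSInput P w) {R : ℝ → ℝ}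
    (hR : ∀ i j s t, ∫ o, w i s o * w j t o ∂P = if i = j then R (t - s) else 0)
    (hx : IsNetworkSolution P A b c G w x) (hy : HasBoundedPower P (output c x)) (i j : Fin N)
    (t τ : ℝ) :
    crossCorrAt P (output c x i) (output c x j) t τ =
      ∑ k, ∫ p : ℝ × ℝ, (impulseResponse A b c G p.1 i k * impulseResponse A b c G p.2 j k)
        * R (τ - (p.1 - p.2))
        ∂((volume.restrict (Set.Ioi 0)).prod (volume.restrict (Set.Ioi 0))) := by
  rw [← hw.integral_filteredSum_mul hR (integrableOn_impulseResponse hM) i j t τ, crossCorrAt]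
  refine integral_congr_ae ?_
  filter_upwards [ae_output_eq_filteredSum hM hw hR hx hy i t,
    ae_output_eq_filteredSum hM hw hR hx hy j (t - τ)] with o h1 h2
  rw [h1, h2]

theorem integrable_impulseResponse_corr
    (hM : IsHurwitz (networkMatrix A b c G)) {R : ℝ → ℝ} (hRm : StronglyMeasurable R)
    (hRi : Integrable R) (i j k : Fin N) :
    Integrable fun τ => ∫ p : ℝ × ℝ,
      (impulseResponse A b c G p.1 i k * impulseResponse A b c G p.2 j k) * R (τ - (p.1 - p.2))
        ∂((volume.restrict (Set.Ioi 0)).prod (volume.restrict (Set.Ioi 0))) :=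
  integrable_integral_mul_comp_sub (φ := fun p : ℝ × ℝ => p.1 - p.2)
    ((integrableOn_impulseResponse hM i k).mul_prod (integrableOn_impulseResponse hM j k))
    (measurable_fst.sub measurable_snd) hRm hRi

/-- The phase of p.1 - p.2 splits into two factors; the opposite sign on p.2 and the reality of the
impulse response produce the conjugate. -/
theorem angularFourier_impulseResponse_corr
    (hM : IsHurwitz (networkMatrix A b c G)) {R : ℝ → ℝ} (hRm : StronglyMeasurable R)
    (hRi : Integrable R) (i j k : Fin N) (ω : ℝ) :
    angularFourier (fun τ => ∫ p : ℝ × ℝ,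
      (impulseResponse A b c G p.1 i k * impulseResponse A b c G p.2 j k) * R (τ - (p.1 - p.2))
        ∂((volume.restrict (Set.Ioi 0)).prod (volume.restrict (Set.Ioi 0)))) ω =
      transferMatrix A b c G ω i k * star (transferMatrix A b c G ω j k) * angularFourier R ω := by
  rw [angularFourier_integral_mul_comp_sub (φ := fun p : ℝ × ℝ => p.1 - p.2)
    ((integrableOn_impulseResponse hM i k).mul_prod (integrableOn_impulseResponse hM j k))
    (measurable_fst.sub measurable_snd) hRm hRi]
  congr 1
  rw [transferMatrix, of_apply, of_apply, Complex.star_def, ← integral_conj, ← integral_prod_mul]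
  refine integral_congr_ae (Eventually.of_forall fun p => ?_)
  simp only [map_mul, Complex.conj_ofReal, ← Complex.exp_conj, map_neg, Complex.conj_I]
  push_cast
  rw [show -(Complex.I * (ω : ℂ) * ((p.1 : ℂ) - (p.2 : ℂ)))
    = -(Complex.I * ω * p.1) + -(-Complex.I * ω * p.2) by ring, Complex.exp_add]
  ring

end SteadyState

end DynNet

/-! ### Assembly of the main theorem. -/

theorem lemma3 {Ω : Type*} [MeasurableSpace Ω] (P : Measure Ω) [IsProbabilityMeasure P]
    {N n : ℕ} (A : Matrix (Fin n) (Fin n) ℝ) (b c : Fin n → ℝ) (G : Matrix (Fin N) (Fin N) ℝ)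
    (hstable : DynNet.IsHurwitz (DynNet.networkMatrix A b c G))
    (w : Fin N → ℝ → Ω → ℝ) (x : Fin N → ℝ → Ω → Fin n → ℝ)
    (hw : DynNet.IsUncorrelatedWSSInput P w)
    (hwS : ∀ i, DynNet.HasCPSD P (w i) (w i))
    (W : ℝ) (hW : DynNet.IsExcitationInterval P w W)
    (hx : DynNet.IsNetworkSolution P A b c G w x)
    (hy : DynNet.HasBoundedPower P (DynNet.output c x))
    (lam : ℝ) (u : Fin N → ℝ) (hGu : G *ᵥ u = lam • u) (hu : u ⬝ᵥ u = 1) :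
    DynNet.JointlyWSS P (DynNet.output c x) ∧
    (∀ i j, DynNet.HasCPSD P (DynNet.output c x i) (DynNet.output c x j)) ∧
    ∀ ω ∈ Set.Ioo (-W) W,
      IsUnit (DynNet.resolventMatrix A (Complex.I * (ω : ℂ))).det →
      DynNet.nodalTransfer A b c (Complex.I * (ω : ℂ)) ≠ 0 →
      IsUnit (DynNet.cpsdMatrix P (DynNet.output c x) ω).det ∧
      (fun k => (u k : ℂ)) ⬝ᵥ
        ((DynNet.cpsdMatrix P (DynNet.output c x) ω)⁻¹ *ᵥ (fun k => (u k : ℂ))) ≠ 0 ∧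
      ∀ i, DynNet.psd P (w i) ω =
        ((lam ^ 2 * ‖DynNet.nodalTransfer A b c (Complex.I * (ω : ℂ))‖ ^ 2
            - 2 * lam * (DynNet.nodalTransfer A b c (Complex.I * (ω : ℂ))).re + 1 : ℝ) : ℂ) /
          (((fun k => (u k : ℂ)) ⬝ᵥ
              ((DynNet.cpsdMatrix P (DynNet.output c x) ω)⁻¹ *ᵥ (fun k => (u k : ℂ)))) *
            ((‖DynNet.nodalTransfer A b c (Complex.I * (ω : ℂ))‖ ^ 2 : ℝ) : ℂ)) := by
  obtain ⟨R, hR⟩ := hw.exists_corr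
  have hcorr := DynNet.crossCorrAt_output_eq hstable hw hR hx hy
  -- An index is kept as an argument because for N = 0 nothing constrains R.
  have hRm : ∀ _ : Fin N, StronglyMeasurable R := fun i => hw.stronglyMeasurable_autocorr hR i
  have hRi : ∀ _ : Fin N, Integrable R := fun i => by
    have h := hwS i
    rwa [DynNet.HasCPSD, DynNet.crossCorr_self_eq hR] at h
  have hcc : ∀ i j, DynNet.crossCorr P (DynNet.output c x i) (DynNet.output c x j) = fun τ =>
      ∑ k, ∫ p : ℝ × ℝ,
        (DynNet.impulseResponse A b c G p.1 i k * DynNet.impulseResponse A b c G p.2 j k)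
          * R (τ - (p.1 - p.2))
          ∂((volume.restrict (Set.Ioi 0)).prod (volume.restrict (Set.Ioi 0))) :=
    fun i j => funext fun τ => hcorr i j 0 τ
  have hint := fun i j k =>
    DynNet.integrable_impulseResponse_corr hstable (hRm i) (hRi i) i j k
  refine ⟨⟨fun i t => (hy.choose_spec i t).1, fun i s t => ?_, fun i j s t τ => ?_⟩,
    fun i j => ?_, fun ω hω hA hh => ?_⟩
  · have hmean : ∀ t, ∫ o, DynNet.output c x i t o ∂P = 0 := fun t => by
      rw [integral_congr_ae (DynNet.ae_output_eq_filteredSum hstable hw hR hx hy i t)]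
      exact hw.integral_filteredSum hR (DynNet.integrableOn_impulseResponse hstable) i t
    rw [hmean, hmean]
  · rw [hcorr, hcorr]
  · rw [DynNet.HasCPSD, hcc]
    exact integrable_finsetSum _ fun k _ => hint i j k
  · have hpsd : ∀ i, DynNet.psd P (w i) ω = DynNet.angularFourier R ω := fun i => by
      rw [DynNet.psd, DynNet.cpsd, DynNet.crossCorr_self_eq hR]
    -- The normalization uᵀu = 1 excludes N = 0, so some input witnesses that the density is
    -- nonzero.
    have hN : Nonempty (Fin N) := by
      by_contra h
      rw [not_nonempty_iff] at h
      simp [dotProduct] at hu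
    have hσ : DynNet.angularFourier R ω ≠ 0 := fun h0 => by
      have h1 := hW.2 ω hω hN.some
      rw [hpsd, h0] at h1
      simp at h1
    have hS : DynNet.cpsdMatrix P (DynNet.output c x) ω = DynNet.angularFourier R ω •
        (DynNet.transferMatrix A b c G ω * (DynNet.transferMatrix A b c G ω)ᴴ) := by
      ext i j
      rw [DynNet.cpsdMatrix, of_apply, DynNet.cpsd, hcc,
        DynNet.angularFourier_finset_sum _ _ (hint i j), Matrix.smul_apply, mul_apply,
        smul_eq_mul, Finset.mul_sum]
      refine Finset.sum_congr rfl fun k _ => ?_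
      rw [DynNet.angularFourier_impulseResponse_corr hstable (hRm i) (hRi i), conjTranspose_apply,
        mul_comm]
    obtain ⟨h1, h2, h3⟩ := DynNet.eigenpair_determines_psd G _ _ _ _ hh hσ
      (DynNet.transferMatrix_identity hstable ω hA) hS lam u hGu hu
    exact ⟨h1, h2, fun i => (hpsd i).trans h3⟩
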